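/- **Theorem 1.1.** An offspring distribution is a probability distribution $q=(q_n)_{n\ge 0}$ on the nonnegative integers, and $\mathbf P_q$ denotes the Galton–Watson measure: the law of the random rooted tree in which the numbers of children of the vertices are IID with distribution $q$. For a locally finite rooted tree $\Gamma$ with root $\rho$, a closed set $B\subseteq\mathbb R^\infty$ (product topology) and a probability distribution $F$ on $\mathbb R$, let $P(\Gamma;B;F)$ be the probability that, when the vertices $v$ of $\Gamma$ carry IID labels $X(v)$ with distribution $F$, there is an infinite non-self-intersecting path $\rho,v_1,v_2,\dots$ in $\Gamma$ with $(X(v_1),X(v_2),\dots)\in B$. The set $B$ is *polar* for $\Gamma$ (with label distribution $F$) if $P(\Gamma;B;F)=0$. Two trees are *equipolar* if, for every $F$, every closed $B\subseteq\mathbb R^\infty$ is polar for both trees or for neither. Let $q$ and $q'$ be offspring distributions with $q_0=q_0'=0$, with the same mean $m=\sum_n nq_n=\sum_n nq_n'$, where $1<m<\infty$, and with $\sum_n n^2q_n<\infty$ and $\sum_n n^2q_n'<\infty$. Then $\mathbf P_q\times\mathbf P_{q'}$-almost every pair $(\Gamma,\Gamma')$ is equipolar. Moreover, for $\mathbf P_q\times\mathbf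 P_{q'}$-almost every pair $(\Gamma,\Gamma')$, $$\sup_{B,F}\frac{P(\Gamma;B;F)}{P(\Gamma';B;F)}<\infty ,$$ where the supremum is over all closed $B\subseteq\mathbb R^\infty$ and all probability distributions $F$ on $\mathbb R$, with the conventions $0/0=0$ and $a/0=\infty$ for $a>0$. -/

import Mathlib

open MeasureTheory
open scoped ENNReal

/-- A rooted, locally finite tree in Ulam-Harris coding. A vertex is the word of birth ranks read
from the vertex back to the root, so that the root is `[]`, the children of `v` are the words
`i :: v`, and the distance of `v` from the root is `v.length`. The children of a vertex are
`0 :: v, …, (k - 1) :: v` for some finite `k`. -/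
@[ext]
structure PlaneTree where
  verts : Set (List ℕ)
  root_mem : [] ∈ verts
  parent_mem : ∀ (i : ℕ) (v : List ℕ), i :: v ∈ verts → v ∈ verts
  sibling_mem : ∀ (i j : ℕ) (v : List ℕ), j < i → i :: v ∈ verts → j :: v ∈ verts
  locallyFinite : ∀ v : List ℕ, {i : ℕ | i :: v ∈ verts}.Finite

namespace PlaneTree

/-- The vertex at distance `n` from the root on the path that takes the children of ranks
`ξ 0, ξ 1, …` in this order. -/
def pathVertex (ξ : ℕ → ℕ) : ℕ → List ℕ
  | 0 => []
  | n + 1 => ξ n :: pathVertex ξ n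

/-- The boundary of `Γ`: the infinite non-self-intersecting paths from the root. -/
def boundary (Γ : PlaneTree) : Set (ℕ → ℕ) :=
  {ξ | ∀ n, pathVertex ξ n ∈ Γ.verts}

/-- The labels `(X(v₁), X(v₂), …)` along the path `root, v₁, v₂, …`. The root's own label is not
used. -/
def labelsAlong (Γ : PlaneTree) (X : Γ.verts → ℝ) (ξ : Γ.boundary) : ℕ → ℝ :=
  fun n => X ⟨pathVertex ξ.1 (n + 1), ξ.2 (n + 1)⟩

/-- The event `A(Γ; B)`: some infinite path from the root has its label sequence in `B`. -/
def hitEvent (Γ : PlaneTree) (B : Set (ℕ → ℝ)) : Set (Γ.verts → ℝ) :=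
  {X | ∃ ξ : Γ.boundary, Γ.labelsAlong X ξ ∈ B}

/-- `P(Γ; B; F)`: the probability of `A(Γ; B)` when the vertices of `Γ` carry IID labels with
common distribution `F`. -/
noncomputable def hitProb (Γ : PlaneTree) (B : Set (ℕ → ℝ)) (F : ProbabilityMeasure ℝ) : ℝ≥0∞ :=
  Measure.infinitePi (fun _ : Γ.verts => (F : Measure ℝ)) (Γ.hitEvent B)

/-- `B` is polar for `Γ` (with label distribution `F`). -/
def Polar (Γ : PlaneTree) (B : Set (ℕ → ℝ)) (F : ProbabilityMeasure ℝ) : Prop :=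
  Γ.hitProb B F = 0

/-- Two trees are equipolar if, whatever the label distribution, they have the same closed polar
sets; closed refers to the product topology of `ℕ → ℝ`. -/
def Equipolar (Γ Γ' : PlaneTree) : Prop :=
  ∀ (F : ProbabilityMeasure ℝ) (B : Set (ℕ → ℝ)), IsClosed B → (Γ.Polar B F ↔ Γ'.Polar B F)

/-- Membership in the tree in which the vertex `v` has `N v` children. -/
def MemOffspring (N : List ℕ → ℕ) : List ℕ → Prop
  | [] => True
  | i :: v => MemOffspring N v ∧ i < N v

/-- The tree in which each vertex `v` has `N v` children. -/
def ofOffspring (N : List ℕ → ℕ) : PlaneTree where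
  verts := {v | MemOffspring N v}
  root_mem := trivial
  parent_mem := fun _ _ h => h.1
  sibling_mem := fun _ _ _ hij h => ⟨h.1, hij.trans h.2⟩
  locallyFinite := fun v => (Set.finite_Iio (N v)).subset fun _ h => h.2

/-- The σ-algebra on trees generated by the events `v ∈ Γ`. -/
instance : MeasurableSpace PlaneTree :=
  MeasurableSpace.generateFrom {S | ∃ v : List ℕ, S = {Γ : PlaneTree | v ∈ Γ.verts}}

theorem measurable_ofOffspring : Measurable ofOffspring := by
  refine measurable_generateFrom ?_
  rintro _ ⟨v, rfl⟩
  change MeasurableSet {N : List ℕ → ℕ | MemOffspring N v}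
  induction v with
  | nil => exact MeasurableSet.univ
  | cons i v ih =>
    exact ih.inter ((measurable_pi_apply v) (MeasurableSet.of_discrete (s := {n : ℕ | i < n})))

/-- The Galton-Watson measure `P_q`: the law of the random tree whose vertices have IID numbers of
children with common distribution `q`. -/
noncomputable def galtonWatson (q : PMF ℕ) : Measure PlaneTree :=
  (Measure.infinitePi (fun _ : List ℕ => q.toMeasure)).map ofOffspring

instance (q : PMF ℕ) : IsProbabilityMeasure (galtonWatson q) :=
  Measure.isProbabilityMeasure_map measurable_ofOffspring.aemeasurable

end PlaneTree

/-!
Fix a label law `F` and a closed set `B`, replace `B` by the set `D` of sequences whose first `n`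
terms are approximated by those of elements of `B`, and let `s` be the probability of hitting `D`
with a fictitious regular tree in which each vertex has `m` children, `m` being a real number. It is
defined by the recursion `c = (∫ c(x, y) dF(y)) ^ m` for the escape probabilities
(`regularEscape`). The hitting probability of a typical Galton-Watson tree with mean `m` agrees with
`s` up to constants that depend on the tree alone. The theorem follows upon letting `n → ∞`, which
is a compactness argument (`pathHit_eq_iInter`).

*Upper bound.* If level `k` has at most `A * m ^ k` vertices for each `k`, then the hitting
probability is at most `A * s`. By Hölder's inequality the product of the escape probabilities over
level `k` is at least the `A * m ^ k`-th power of that of the regular tree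
(`regularEscape_rpow_le_prod_escape`).

*Lower bound.* If the tree carries a flow `θ` with `∑ θ(v) ^ 2 ≤ C * m ^ (-k)` over each level `k`,
then the hitting probability is at least a constant times `s`. This is a second moment estimate,
carried out by induction on the level: `∑ θ(v) ^ 2 / p(v)`, where `p(v)` is the hitting probability
from `v`, is at most a multiple of `m ^ (-k) / s` over level `k` (`sum_sq_div_escape_le`). The
energy that level `k` contributes is absorbed by the strict concavity of `t ↦ 1 - (1 - t) ^ m`
(`inv_add_le_inv_one_sub_rpow`).

*Galton-Watson trees.* With `W(v)` the asymptotic size of the subtree at `v`, normalised by powers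
of `m`, the flow is `θ(v) = m ^ (-k) * W(v)` for `v` in level `k`. The increments of the normalised
level sizes decay geometrically in mean square (`lintegral_sq_ratioBound_lt_top`), so the level
sizes are `O(m ^ k)` and `W` has a finite second moment; it is positive since there are no leaves
(`ae_limitRatio_ne_zero`). The sums of `W(v) ^ 2` over the levels are `O(m ^ k)` by a law of large
numbers for the independent variables `W(v)`, obtained by truncating `W(v) ^ 2` at `m ^ k`
(`ae_energy_lt_top`).
-/

namespace PlaneTree

/-! ### Elementary inequalities -/

/-- A second-order refinement of `1 - (1 - t) ^ m ≤ m * t`, in the form in which conductances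
compose: passing through one generation of an `m`-ary tree costs at least the resistance
`(m - 1) / (2 * m)`. -/
theorem inv_add_le_inv_one_sub_rpow {m t : ℝ} (hm : 1 < m) (ht : 0 < t) (ht1 : t ≤ 1) :
    (m * t)⁻¹ + (m - 1) / (2 * m) ≤ (1 - (1 - t) ^ m)⁻¹ := by
  have key : ∀ x ∈ Set.Ico (0 : ℝ) 1,
      (1 - x) ^ (m - 1) * (1 + (m - 1) * x) ≤ 1 := by
    rintro x ⟨hx0, hx1⟩
    have h1 : (1 - x) ^ (m - 1) ≤ Real.exp (-((m - 1) * x)) := by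
      have : 1 - x ≤ Real.exp (-x) := by linarith [Real.add_one_le_exp (-x)]
      calc (1 - x) ^ (m - 1) ≤ (Real.exp (-x)) ^ (m - 1) :=
            Real.rpow_le_rpow (by linarith) this (by linarith)
        _ = _ := by rw [← Real.exp_mul]; ring_nf
    have h2 : 1 + (m - 1) * x ≤ Real.exp ((m - 1) * x) := by
      linarith [Real.add_one_le_exp ((m - 1) * x)]
    calc (1 - x) ^ (m - 1) * (1 + (m - 1) * x)
        ≤ Real.exp (-((m - 1) * x)) * Real.exp ((m - 1) * x) :=
          mul_le_mul h1 h2 (by nlinarith) (Real.exp_pos _).le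
      _ = 1 := by rw [← Real.exp_add]; simp
  set b : ℝ := (m - 1) / 2 with hb
  have hmono : MonotoneOn (fun x : ℝ => (1 - x) ^ m * (1 + b * x) - (1 + b * x) + m * x)
      (Set.Icc 0 1) := by
    refine monotoneOn_of_deriv_nonneg (convex_Icc 0 1) ?_ ?_ ?_
    · refine ContinuousOn.add (ContinuousOn.sub (ContinuousOn.mul ?_ ?_) ?_) ?_
      · exact ContinuousOn.rpow_const (by fun_prop) (fun x _ => Or.inr (by linarith))
      all_goals fun_prop
    · intro x hx
      rw [interior_Icc] at hx
      have : DifferentiableAt ℝ (fun x : ℝ => (1 - x) ^ m) x :=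
        DifferentiableAt.rpow_const (by fun_prop) (Or.inl (by linarith [hx.2]))
      exact ((this.mul (by fun_prop)).sub (by fun_prop)).add (by fun_prop)
        |>.differentiableWithinAt
    · intro x hx
      rw [interior_Icc] at hx
      have h0 : HasDerivAt (fun x : ℝ => 1 - x) (-1) x := by
        simpa using (hasDerivAt_id x).const_sub 1
      have h1 := h0.rpow_const (p := m) (Or.inl (by linarith [hx.2]))
      have h2 : HasDerivAt (fun x : ℝ => 1 + b * x) b x := by
        simpa using ((hasDerivAt_id x).const_mul b).const_add 1
      have h3 : HasDerivAt (fun x : ℝ => m * x) m x := by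
        simpa using (hasDerivAt_id x).const_mul m
      have h4 := ((h1.mul h2).sub h2).add h3
      rw [show deriv (fun x : ℝ => (1 - x) ^ m * (1 + b * x) - (1 + b * x) + m * x) x = _ from
        h4.deriv]
      have hk := key x ⟨hx.1.le, hx.2⟩
      have hp : (1 - x) ^ m = (1 - x) ^ (m - 1) * (1 - x) := by
        rw [← Real.rpow_add_one (by linarith [hx.2])]; ring_nf
      rw [hp]
      have : (-1 * m * (1 - x) ^ (m - 1) * (1 + b * x) + (1 - x) ^ (m - 1) * (1 - x) * b) - b + m
          = (m + 1) / 2 * (1 - (1 - x) ^ (m - 1) * (1 + (m - 1) * x)) := by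
        rw [hb]; ring
      rw [this]
      exact mul_nonneg (by linarith) (by linarith)
  have h := hmono (Set.left_mem_Icc.2 zero_le_one) ⟨ht.le, ht1⟩ ht.le
  simp only [sub_zero, Real.one_rpow, mul_zero, add_zero, mul_one, sub_self] at h
  have hlt : (1 - t) ^ m < 1 := Real.rpow_lt_one (by linarith) (by linarith) (by linarith)
  have hbt : 0 < 1 + b * t := by
    have : 0 < b := by rw [hb]; linarith
    positivity
  rw [show (m * t)⁻¹ + (m - 1) / (2 * m) = (1 + b * t) / (m * t) by rw [hb]; field_simp,
    ← one_div, div_le_div_iff₀ (by positivity) (by linarith)]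
  linarith

/-- The inequality `inv_add_le_inv_one_sub_rpow` in `[0, ∞]`, with `c = 1 - t`. -/
theorem inv_add_le_inv_one_sub_rpow_ennreal {m : ℝ} (hm : 1 < m) {c : ℝ≥0∞} (hc : c < 1) :
    (ENNReal.ofReal m * (1 - c))⁻¹ + ENNReal.ofReal ((m - 1) / (2 * m)) ≤ (1 - c ^ m)⁻¹ := by
  lift c to NNReal using (hc.trans ENNReal.one_lt_top).ne
  have hc' : (c : ℝ) < 1 := by exact_mod_cast hc
  have hcm : (c : ℝ) ^ m < 1 := Real.rpow_lt_one c.2 hc' (by linarith)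
  have e1 : (1 : ℝ≥0∞) - c = ENNReal.ofReal (1 - c) := by
    rw [ENNReal.ofReal_sub _ c.coe_nonneg]; simp
  have e2 : (1 : ℝ≥0∞) - (c : ℝ≥0∞) ^ m = ENNReal.ofReal (1 - (c : ℝ) ^ m) := by
    rw [ENNReal.ofReal_sub _ (Real.rpow_nonneg c.coe_nonneg _),
      ← ENNReal.ofReal_rpow_of_nonneg c.coe_nonneg (by linarith)]
    simp
  rw [e1, e2, ← ENNReal.ofReal_mul (by linarith), ← ENNReal.ofReal_inv_of_pos (by nlinarith),
    ← ENNReal.ofReal_inv_of_pos (by linarith), ← ENNReal.ofReal_add (by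
      rw [inv_nonneg]; nlinarith) (div_nonneg (by linarith) (by linarith))]
  refine ENNReal.ofReal_le_ofReal ?_
  have := inv_add_le_inv_one_sub_rpow (t := 1 - c) hm (by linarith) (by linarith [c.2])
  simpa using this

/-- Bernoulli's inequality `(1 - t) ^ a ≥ 1 - a * t` with `c = 1 - t`. -/
theorem one_sub_rpow_le_mul {a : ℝ} (ha : 1 ≤ a) {c : ℝ≥0∞} (hc : c ≤ 1) :
    1 - c ^ a ≤ ENNReal.ofReal a * (1 - c) := by
  lift c to NNReal using (hc.trans_lt ENNReal.one_lt_top).ne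
  have hc' : (c : ℝ) ≤ 1 := by exact_mod_cast hc
  have e1 : (1 : ℝ≥0∞) - c = ENNReal.ofReal (1 - c) := by
    rw [ENNReal.ofReal_sub _ c.coe_nonneg]; simp
  have e2 : (1 : ℝ≥0∞) - (c : ℝ≥0∞) ^ a = ENNReal.ofReal (1 - (c : ℝ) ^ a) := by
    rw [ENNReal.ofReal_sub _ (Real.rpow_nonneg c.coe_nonneg _),
      ← ENNReal.ofReal_rpow_of_nonneg c.coe_nonneg (by linarith)]
    simp
  rw [e1, e2, ← ENNReal.ofReal_mul (by linarith)]
  refine ENNReal.ofReal_le_ofReal ?_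
  have := one_add_mul_self_le_rpow_one_add (s := (c : ℝ) - 1) (by linarith [c.2]) ha
  rw [add_sub_cancel] at this
  linarith

theorem prod_one_sub_mul_le_one {ι : Type*} (s : Finset ι) (t : ι → ℝ)
    (h0 : ∀ i ∈ s, 0 ≤ t i) (h1 : ∀ i ∈ s, t i ≤ 1) :
    (∏ i ∈ s, (1 - t i)) * (1 + ∑ i ∈ s, t i) ≤ 1 := by
  classical
  induction s using Finset.induction_on with
  | empty => simp
  | insert a s ha ih =>
    rw [Finset.prod_insert ha, Finset.sum_insert ha]
    have ih' := ih (fun i hi => h0 i (Finset.mem_insert_of_mem hi))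
      (fun i hi => h1 i (Finset.mem_insert_of_mem hi))
    have hS : 0 ≤ ∑ i ∈ s, t i :=
      Finset.sum_nonneg fun i hi => h0 i (Finset.mem_insert_of_mem hi)
    have hP : 0 ≤ ∏ i ∈ s, (1 - t i) :=
      Finset.prod_nonneg fun i hi => by linarith [h1 i (Finset.mem_insert_of_mem hi)]
    have ha0 := h0 a (Finset.mem_insert_self a s)
    nlinarith [mul_nonneg hP (mul_nonneg ha0 hS), mul_nonneg hP (mul_nonneg ha0 ha0)]

/-- Passing through one vertex of a tree costs at most a unit resistance. -/
theorem inv_one_sub_prod_le {ι : Type*} (s : Finset ι) (c : ι → ℝ≥0∞) (hc : ∀ i ∈ s, c i ≤ 1) :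
    (1 - ∏ i ∈ s, c i)⁻¹ ≤ 1 + (∑ i ∈ s, (1 - c i))⁻¹ := by
  set S := ∑ i ∈ s, (1 - c i) with hS
  have hS_top : S ≠ ∞ := ENNReal.sum_ne_top.2 fun i _ =>
    (tsub_le_self.trans_lt ENNReal.one_lt_top).ne
  rcases eq_or_ne S 0 with h0 | h0
  · simp [h0]
  have hprod : (∏ i ∈ s, c i) * (1 + S) ≤ 1 := by
    have hr := prod_one_sub_mul_le_one s (fun i => (1 - c i).toReal) (fun _ _ => by positivity)
      (fun i _ => ENNReal.toReal_mono ENNReal.one_ne_top tsub_le_self)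
    have e : ∏ i ∈ s, (1 - (1 - c i).toReal) = (∏ i ∈ s, c i).toReal := by
      rw [ENNReal.toReal_prod]
      refine Finset.prod_congr rfl fun i hi => ?_
      rw [ENNReal.toReal_sub_of_le (hc i hi) ENNReal.one_ne_top]; simp
    have hP : ∏ i ∈ s, c i ≤ 1 := Finset.prod_le_one' hc
    rw [e, ← ENNReal.toReal_sum (fun i _ => (tsub_le_self.trans_lt ENNReal.one_lt_top).ne), ← hS,
      show (1 : ℝ) + S.toReal = (1 + S).toReal by
        rw [ENNReal.toReal_add ENNReal.one_ne_top hS_top]; simp, ← ENNReal.toReal_mul,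
      ← ENNReal.toReal_one, ENNReal.toReal_le_toReal _ ENNReal.one_ne_top] at hr
    · exact hr
    · exact ENNReal.mul_ne_top (hP.trans_lt ENNReal.one_lt_top).ne (by finiteness)
  have h1S : 1 + S ≠ ∞ := by finiteness
  have hP : ∏ i ∈ s, c i ≤ (1 + S)⁻¹ := by
    rw [ENNReal.le_inv_iff_mul_le]; exact hprod
  have : S * (1 + S)⁻¹ ≤ 1 - ∏ i ∈ s, c i := by
    refine le_trans ?_ (tsub_le_tsub_left hP 1)
    refine ENNReal.le_sub_of_add_le_left (by simp) ?_
    rw [← one_add_mul, mul_comm, mul_comm]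
    exact (ENNReal.mul_inv_cancel (by simp) h1S).le
  calc (1 - ∏ i ∈ s, c i)⁻¹ ≤ (S * (1 + S)⁻¹)⁻¹ := ENNReal.inv_le_inv.2 this
    _ = S⁻¹ * (1 + S) := by
      rw [ENNReal.mul_inv (Or.inl h0) (Or.inl hS_top), inv_inv]
    _ = 1 + S⁻¹ := by
      rw [mul_add, mul_one, ENNReal.inv_mul_cancel h0 hS_top, add_comm]

/-- The tangent line inequality behind the Cauchy-Schwarz inequality. -/
theorem two_mul_le_sq_div_add {a p : ℝ≥0∞} (l : NNReal) (ha : a ≠ ∞) (hp : p ≠ ∞) :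
    2 * l * a ≤ a ^ 2 / p + l ^ 2 * p := by
  rcases eq_or_ne a 0 with rfl | ha0
  · simp
  rcases eq_or_ne p 0 with rfl | hp0
  · rw [ENNReal.div_zero (by positivity)]; simp
  lift a to NNReal using ha
  lift p to NNReal using hp
  have hp' : p ≠ 0 := by exact_mod_cast hp0
  have hp2 : 0 < (p : ℝ) := by positivity
  rw [← ENNReal.coe_pow, ← ENNReal.coe_div hp']
  norm_cast
  rw [← NNReal.coe_le_coe]
  push_cast
  rw [div_add' _ _ _ hp2.ne', le_div_iff₀ hp2]
  nlinarith [sq_nonneg ((a : ℝ) - l * p)]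

/-- The converse of `two_mul_le_sq_div_add`: the best tangent line recovers `a ^ 2 / p`. -/
theorem sq_div_le_of_forall {a p b : ℝ≥0∞} (hp : p ≠ ∞)
    (h : ∀ l : NNReal, 2 * l * a ≤ b + l ^ 2 * p) : a ^ 2 / p ≤ b := by
  rcases eq_or_ne b ∞ with rfl | hb
  · exact le_top
  have ha : a ≠ ∞ := by
    rintro rfl
    have := h 1
    simp [hb, hp] at this
  rcases eq_or_ne a 0 with rfl | ha0
  · simp
  lift a to NNReal using ha
  lift p to NNReal using hp
  lift b to NNReal using hb
  have h' : ∀ l : NNReal, 2 * (l : ℝ) * a ≤ b + l ^ 2 * p := fun l => by exact_mod_cast h l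
  have ha' : 0 < (a : ℝ) := by
    have : a ≠ 0 := by exact_mod_cast ha0
    positivity
  rcases eq_or_ne p 0 with rfl | hp0
  · have := h' ((b + 1) / a)
    push_cast at this
    rw [mul_assoc, div_mul_cancel₀ _ ha'.ne'] at this
    have hb := b.2
    simp at this
    nlinarith
  have hp2 : 0 < (p : ℝ) := by positivity
  rw [← ENNReal.coe_pow, ← ENNReal.coe_div hp0]
  norm_cast
  rw [← NNReal.coe_le_coe]
  push_cast
  have := h' (a / p)
  push_cast at this
  have e : ((a : ℝ) / p) ^ 2 * p = a ^ 2 / p := by field_simp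
  rw [e, show 2 * ((a : ℝ) / p) * a = 2 * (a ^ 2 / p) by ring] at this
  linarith

/-- The Cauchy-Schwarz inequality for series in `[0, ∞]`, with weights `r`. -/
theorem sq_tsum_div_tsum_le {ι : Type*} {a r : ι → ℝ≥0∞} (ha : ∀ i, a i ≠ ∞)
    (hr : ∑' i, r i ≠ ∞) : (∑' i, a i) ^ 2 / ∑' i, r i ≤ ∑' i, a i ^ 2 / r i := by
  refine sq_div_le_of_forall hr fun l => ?_
  rw [← ENNReal.tsum_mul_left, ← ENNReal.tsum_mul_left, ← ENNReal.tsum_add]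
  exact ENNReal.tsum_le_tsum fun i =>
    two_mul_le_sq_div_add l (ha i) (ENNReal.ne_top_of_tsum_ne_top hr i)

/-! ### Levels of a tree -/

/-- The vertices at distance `k` from the root of `ofOffspring N`. -/
def level (N : List ℕ → ℕ) : ℕ → Finset (List ℕ)
  | 0 => {[]}
  | k + 1 => (level N k).biUnion fun v => (Finset.range (N v)).image (· :: v)

theorem mem_level {N : List ℕ → ℕ} {k : ℕ} {v : List ℕ} :
    v ∈ level N k ↔ v.length = k ∧ MemOffspring N v := by
  induction k generalizing v with
  | zero =>
    simp only [level, Finset.mem_singleton, List.length_eq_zero_iff]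
    exact ⟨fun h => ⟨h, h ▸ trivial⟩, fun h => h.1⟩
  | succ k ih =>
    simp only [level, Finset.mem_biUnion, Finset.mem_image, Finset.mem_range, ih]
    constructor
    · rintro ⟨v, ⟨rfl, hv⟩, i, hi, rfl⟩
      exact ⟨by simp, hv, hi⟩
    · rintro ⟨hl, hm⟩
      cases v with
      | nil => simp at hl
      | cons i v => exact ⟨v, ⟨by simpa using hl, hm.1⟩, i, hm.2, rfl⟩

theorem length_of_mem_level {N : List ℕ → ℕ} {k : ℕ} {v : List ℕ} (h : v ∈ level N k) :
    v.length = k :=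
  (mem_level.1 h).1

theorem prod_level_succ {M : Type*} [CommMonoid M] (N : List ℕ → ℕ) (k : ℕ) (f : List ℕ → M) :
    ∏ w ∈ level N (k + 1), f w = ∏ v ∈ level N k, ∏ i ∈ Finset.range (N v), f (i :: v) := by
  rw [level, Finset.prod_biUnion]
  · refine Finset.prod_congr rfl fun v _ => Finset.prod_image fun i _ j _ h => by simpa using h
  · intro v _ w _ hvw
    rw [Function.onFun, Finset.disjoint_left]
    simp only [Finset.mem_image]
    rintro _ ⟨i, -, rfl⟩ ⟨j, -, h⟩
    exact hvw (by simp_all)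

theorem sum_level_succ {M : Type*} [AddCommMonoid M] (N : List ℕ → ℕ) (k : ℕ)
    (f : List ℕ → M) :
    ∑ w ∈ level N (k + 1), f w = ∑ v ∈ level N k, ∑ i ∈ Finset.range (N v), f (i :: v) :=
  prod_level_succ (M := Multiplicative M) N k f

/-! ### Escape probabilities -/

/-- The probability that the target `D` is avoided by the paths of length `j` that start at the
vertex `v`, given that the labels on the way to `v` are the first `v.length` terms of `x`. -/
noncomputable def escape (N : List ℕ → ℕ) (F : Measure ℝ) (D : Set (ℕ → ℝ)) :
    ℕ → List ℕ → (ℕ → ℝ) → ℝ≥0∞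
  | 0, _, x => Dᶜ.indicator 1 x
  | j + 1, v, x =>
    ∏ i ∈ Finset.range (N v), ∫⁻ y, escape N F D j (i :: v) (Function.update x v.length y) ∂F

/-- The quantity `escape` at the vertices of level `k` of a fictitious tree in which each vertex
has `m` children, for a real number `m`. -/
noncomputable def regularEscape (m : ℝ) (F : Measure ℝ) (D : Set (ℕ → ℝ)) :
    ℕ → ℕ → (ℕ → ℝ) → ℝ≥0∞
  | 0, _, x => Dᶜ.indicator 1 x
  | j + 1, k, x => (∫⁻ y, regularEscape m F D j (k + 1) (Function.update x k y) ∂F) ^ m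

section Escape

variable {N : List ℕ → ℕ} {F : Measure ℝ} [IsProbabilityMeasure F] {D : Set (ℕ → ℝ)} {m : ℝ}

theorem measurable_update_pair (k : ℕ) :
    Measurable fun p : (ℕ → ℝ) × ℝ => Function.update p.1 k p.2 :=
  measurable_update'

theorem measurable_escape (hD : MeasurableSet D) (j : ℕ) (v : List ℕ) :
    Measurable (escape N F D j v) := by
  induction j generalizing v with
  | zero => exact measurable_one.indicator hD.compl
  | succ j ih =>
    refine Finset.measurable_prod _ fun i _ => ?_
    exact ((ih (i :: v)).comp (measurable_update_pair v.length)).lintegral_prod_right'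

theorem measurable_regularEscape (hD : MeasurableSet D) (j k : ℕ) :
    Measurable (regularEscape m F D j k) := by
  induction j generalizing k with
  | zero => exact measurable_one.indicator hD.compl
  | succ j ih =>
    exact (((ih (k + 1)).comp (measurable_update_pair k)).lintegral_prod_right').pow_const m

theorem lintegral_le_one_of_le_one {f : ℝ → ℝ≥0∞} (hf : ∀ y, f y ≤ 1) : ∫⁻ y, f y ∂F ≤ 1 :=
  (lintegral_mono hf).trans (by simp)

theorem escape_le_one (j : ℕ) (v : List ℕ) (x : ℕ → ℝ) : escape N F D j v x ≤ 1 := by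
  induction j generalizing v x with
  | zero => exact Set.indicator_le_self' (by simp) x
  | succ j ih =>
    exact Finset.prod_le_one' fun i _ => lintegral_le_one_of_le_one fun y => ih _ _

theorem regularEscape_le_one (hm : 0 ≤ m) (j k : ℕ) (x : ℕ → ℝ) :
    regularEscape m F D j k x ≤ 1 := by
  induction j generalizing k x with
  | zero => exact Set.indicator_le_self' (by simp) x
  | succ j ih => exact ENNReal.rpow_le_one (lintegral_le_one_of_le_one fun y => ih _ _) hm

theorem lintegral_one_sub {f : ℝ → ℝ≥0∞} (hf : Measurable f) (hf1 : ∀ y, f y ≤ 1) :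
    ∫⁻ y, (1 - f y) ∂F = 1 - ∫⁻ y, f y ∂F := by
  rw [lintegral_sub hf ((lintegral_le_one_of_le_one hf1).trans_lt ENNReal.one_lt_top).ne
    (Filter.Eventually.of_forall hf1)]
  simp

/-- A Hölder inequality on a probability space, in which the number `s.card` of factors may fall
short of the exponent `M`. -/
theorem lintegral_prod_rpow_le {ι : Type*} (s : Finset ι) {f : ι → ℝ → ℝ≥0∞}
    (hf : ∀ i, Measurable (f i)) {M : ℝ} (hM : 0 < M) (hs : (s.card : ℝ) ≤ M) :
    (∫⁻ y, (∏ i ∈ s, f i y) ^ M⁻¹ ∂F) ^ M ≤ ∏ i ∈ s, ∫⁻ y, f i y ∂F := by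
  have h := ENNReal.lintegral_mul_prod_norm_pow_le (μ := F) s (g := fun _ => 1) (f := f)
    aemeasurable_const (fun i _ => (hf i).aemeasurable) (1 - s.card * M⁻¹) (p := fun _ => M⁻¹)
    (by simp) (by rw [sub_nonneg, ← div_eq_mul_inv]; exact div_le_one_of_le₀ hs hM.le)
    (fun _ _ => (inv_pos.2 hM).le)
  simp only [ENNReal.one_rpow, one_mul, lintegral_const, measure_univ] at h
  simp_rw [ENNReal.prod_rpow_of_nonneg (inv_pos.2 hM).le] at h
  calc _ ≤ ((∏ i ∈ s, ∫⁻ y, f i y ∂F) ^ M⁻¹) ^ M := ENNReal.rpow_le_rpow h hM.le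
    _ = _ := by rw [← ENNReal.rpow_mul, inv_mul_cancel₀ hM.ne', ENNReal.rpow_one]

/-- Among the trees whose levels grow no faster than `A * m ^ k`, the regular one is the easiest
to hit with. It is the geometric mean of the escape probabilities over a level that can be carried
from one level to the previous one, by Hölder's inequality. -/
theorem regularEscape_rpow_le_prod_escape {A : ℝ} (hA : 0 < A) (hm : 0 < m)
    (hN : ∀ k, ((level N k).card : ℝ) ≤ A * m ^ k) (hD : MeasurableSet D) (j k : ℕ) (x : ℕ → ℝ) :
    regularEscape m F D j k x ^ (A * m ^ k) ≤ ∏ v ∈ level N k, escape N F D j v x := by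
  induction j generalizing k x with
  | zero =>
    have hpos : 0 < A * m ^ k := by positivity
    by_cases hx : x ∈ D <;> simp [regularEscape, escape, hx, hpos]
  | succ j ih =>
    have hpos : 0 < A * m ^ (k + 1) := by positivity
    have e : ∏ v ∈ level N k, escape N F D (j + 1) v x =
        ∏ w ∈ level N (k + 1), ∫⁻ y, escape N F D j w (Function.update x k y) ∂F := by
      rw [prod_level_succ]
      refine Finset.prod_congr rfl fun v hv => ?_
      rw [escape, length_of_mem_level hv]
    rw [e]
    refine le_trans ?_ (lintegral_prod_rpow_le (level N (k + 1)) (fun w =>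
      (measurable_escape hD j w).comp (measurable_update x)) hpos (hN (k + 1)))
    rw [regularEscape, ← ENNReal.rpow_mul, show m * (A * m ^ k) = A * m ^ (k + 1) by ring]
    refine ENNReal.rpow_le_rpow (lintegral_mono fun y => ?_) hpos.le
    calc _ = (regularEscape m F D j (k + 1) (Function.update x k y) ^ (A * m ^ (k + 1))) ^
          (A * m ^ (k + 1))⁻¹ := by
          rw [← ENNReal.rpow_mul, mul_inv_cancel₀ hpos.ne', ENNReal.rpow_one]
      _ ≤ _ := ENNReal.rpow_le_rpow (ih _ _) (inv_pos.2 hpos).le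

/-- The Cauchy-Schwarz step: if a flow of strength at most `∑ θ i` splits into the amounts `θ i`
over the children `i` of a vertex, and with density `g` over their labels, then its energy, weighted
by the inverse hitting probabilities of the children, bounds that of the vertex. -/
theorem sq_div_sum_lintegral_le {ι : Type*} (s : Finset ι) {a : ℝ≥0∞} {θ : ι → ℝ≥0∞}
    {g : ℝ → ℝ≥0∞} {p : ι → ℝ → ℝ≥0∞} (hθ : ∀ i, θ i ≠ ∞) (ha : a ≤ ∑ i ∈ s, θ i)
    (hg : Measurable g) (hg' : ∀ y, g y ≠ ∞) (hg1 : ∫⁻ y, g y ∂F = 1)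
    (hp : ∀ i, Measurable (p i)) (hp1 : ∀ i y, p i y ≤ 1) :
    a ^ 2 / ∑ i ∈ s, ∫⁻ y, p i y ∂F ≤ ∑ i ∈ s, ∫⁻ y, g y ^ 2 * (θ i ^ 2 / p i y) ∂F := by
  refine sq_div_le_of_forall (ENNReal.sum_ne_top.2 fun i _ =>
    ((lintegral_le_one_of_le_one (hp1 i)).trans_lt ENNReal.one_lt_top).ne) fun l => ?_
  calc 2 * l * a ≤ 2 * l * ∑ i ∈ s, θ i := by gcongr
    _ = ∑ i ∈ s, ∫⁻ y, 2 * l * (θ i * g y) ∂F := by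
      rw [Finset.mul_sum]
      refine Finset.sum_congr rfl fun i _ => ?_
      rw [lintegral_const_mul _ (hg.const_mul _), lintegral_const_mul _ hg, hg1, mul_one]
    _ ≤ ∑ i ∈ s, ∫⁻ y, (g y ^ 2 * (θ i ^ 2 / p i y) + l ^ 2 * p i y) ∂F := by
      gcongr with i _ y
      refine (two_mul_le_sq_div_add l (ENNReal.mul_ne_top (hθ i) (hg' y))
        ((hp1 i y).trans_lt ENNReal.one_lt_top).ne).trans_eq ?_
      rw [mul_pow, mul_comm (θ i ^ 2), mul_div_assoc]
    _ = _ := by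
      rw [Finset.mul_sum, ← Finset.sum_add_distrib]
      refine Finset.sum_congr rfl fun i _ => ?_
      rw [lintegral_add_right _ ((hp i).const_mul _), lintegral_const_mul _ (hp i)]

/-- The second moment bound. If `θ` is a flow on the tree whose energy at each level `k` is at most
a multiple of `m ^ (-k)`, as on the regular tree, then the tree hits at least as easily as the
regular tree, up to a constant factor. This is the case `k = 0`; the sums over level `k` are what
can be carried from one level to the previous one. -/
theorem sum_sq_div_escape_le (hm : 1 < m) {C : ℝ≥0∞} (hC : C ≠ 0)
    {θ : List ℕ → ℝ≥0∞} (hθ : ∀ v, θ v ≠ ∞)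
    (hflow : ∀ v, θ v ≤ ∑ i ∈ Finset.range (N v), θ (i :: v))
    (henergy : ∀ k, ∑ v ∈ level N k, θ v ^ 2 ≤
      C * ENNReal.ofReal ((m - 1) / (2 * m)) * (ENNReal.ofReal m ^ k)⁻¹)
    (hD : MeasurableSet D) (j k : ℕ) (x : ℕ → ℝ) :
    ∑ v ∈ level N k, θ v ^ 2 / (1 - escape N F D j v x) ≤
      C * (ENNReal.ofReal m ^ k)⁻¹ / (1 - regularEscape m F D j k x) := by
  have hm0 : 0 ≤ m := by linarith
  have hmE : ENNReal.ofReal m ≠ 0 := by simp; linarith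
  have hCk : ∀ k, C * (ENNReal.ofReal m ^ k)⁻¹ ≠ 0 := fun k =>
    mul_ne_zero hC (ENNReal.inv_ne_zero.2 (by finiteness))
  have hδ : ENNReal.ofReal ((m - 1) / (2 * m)) ≤ 1 := by
    rw [ENNReal.ofReal_le_one, div_le_one (by linarith)]; linarith
  induction j generalizing k x with
  | zero =>
    by_cases hx : x ∈ D
    · simp only [escape, regularEscape, Set.mem_compl_iff, hx, not_true_eq_false,
        not_false_eq_true, Set.indicator_of_notMem, tsub_zero, div_one]
      refine (henergy k).trans ?_
      gcongr
      exact mul_le_of_le_one_right' hδ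
    · simp only [regularEscape, Set.mem_compl_iff, hx, not_false_eq_true, Set.indicator_of_mem,
        Pi.one_apply, tsub_self, ENNReal.div_zero (hCk k), le_top]
  | succ j ih =>
    set c := ∫⁻ y, regularEscape m F D j (k + 1) (Function.update x k y) ∂F with hc
    have hs1 : ∀ y, regularEscape m F D j (k + 1) (Function.update x k y) ≤ 1 := fun y =>
      regularEscape_le_one hm0 _ _ _
    have hsm : Measurable fun y => regularEscape m F D j (k + 1) (Function.update x k y) :=
      (measurable_regularEscape hD j (k + 1)).comp (measurable_update x)
    have hc1 : c ≤ 1 := lintegral_le_one_of_le_one hs1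
    rcases hc1.eq_or_lt with h1 | hlt
    · rw [regularEscape, ← hc, h1, ENNReal.one_rpow, tsub_self, ENNReal.div_zero (hCk k)]
      exact le_top
    -- the density of the flow that is optimal for the regular tree
    set t := 1 - c with ht
    have ht0 : t ≠ 0 := (tsub_pos_of_lt hlt).ne'
    have htt : t ≠ ∞ := (tsub_le_self.trans_lt ENNReal.one_lt_top).ne
    set s : ℝ → ℝ≥0∞ := fun y => 1 - regularEscape m F D j (k + 1) (Function.update x k y)
    have hs : Measurable s := measurable_const.sub hsm
    have hst : ∫⁻ y, s y ∂F = t := lintegral_one_sub hsm hs1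
    have hs_top : ∀ y, s y ≠ ∞ := fun y => (tsub_le_self.trans_lt ENNReal.one_lt_top).ne
    set g : ℝ → ℝ≥0∞ := fun y => t⁻¹ * s y with hgdef
    have hg : Measurable g := hs.const_mul _
    have hg1 : ∫⁻ y, g y ∂F = 1 := by
      rw [lintegral_const_mul _ hs, hst, ENNReal.inv_mul_cancel ht0 htt]
    have hgtop : ∀ y, g y ≠ ∞ := fun y =>
      ENNReal.mul_ne_top (ENNReal.inv_ne_top.2 ht0) (hs_top y)
    set p : List ℕ → ℝ → ℝ≥0∞ := fun w y => 1 - escape N F D j w (Function.update x k y) with hpdef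
    have hp : ∀ w, Measurable (p w) := fun w =>
      measurable_const.sub ((measurable_escape hD j w).comp (measurable_update x))
    have hstep : ∀ v ∈ level N k, θ v ^ 2 / (1 - escape N F D (j + 1) v x) ≤
        θ v ^ 2 + ∑ i ∈ Finset.range (N v), ∫⁻ y, g y ^ 2 * (θ (i :: v) ^ 2 / p (i :: v) y) ∂F := by
      intro v hv
      have h1 := inv_one_sub_prod_le (Finset.range (N v))
        (fun i => ∫⁻ y, escape N F D j (i :: v) (Function.update x k y) ∂F)
        (fun i _ => lintegral_le_one_of_le_one fun y => escape_le_one _ _ _)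
      have h2 := sq_div_sum_lintegral_le (F := F) (Finset.range (N v)) (θ := fun i => θ (i :: v))
        (p := fun i => p (i :: v)) (fun i => hθ _) (hflow v) hg hgtop hg1 (fun i => hp _)
        (fun i y => tsub_le_self)
      have h3 : ∀ i, ∫⁻ y, p (i :: v) y ∂F =
          1 - ∫⁻ y, escape N F D j (i :: v) (Function.update x k y) ∂F := fun i =>
        lintegral_one_sub ((measurable_escape hD j _).comp (measurable_update x))
          (fun y => escape_le_one _ _ _)
      rw [escape, length_of_mem_level hv]
      simp_rw [h3] at h2
      calc _ ≤ θ v ^ 2 * (1 + _) := by rw [div_eq_mul_inv]; gcongr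
        _ = θ v ^ 2 + θ v ^ 2 / _ := by rw [mul_add, mul_one, div_eq_mul_inv]
        _ ≤ _ := by gcongr
    have hintg : ∀ y, g y ^ 2 * (C * (ENNReal.ofReal m ^ (k + 1))⁻¹ / s y) ≤
        C * (ENNReal.ofReal m ^ (k + 1))⁻¹ * (t⁻¹ * t⁻¹) * s y := by
      intro y
      rcases eq_or_ne (s y) 0 with h0 | h0
      · simp [hgdef, h0]
      · refine le_of_eq ?_
        simp only [hgdef, div_eq_mul_inv]
        calc _ = C * (ENNReal.ofReal m ^ (k + 1))⁻¹ * (t⁻¹ * t⁻¹) * s y * (s y * (s y)⁻¹) := by ring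
          _ = _ := by rw [ENNReal.mul_inv_cancel h0 (hs_top y), mul_one]
    calc ∑ v ∈ level N k, θ v ^ 2 / (1 - escape N F D (j + 1) v x)
        ≤ ∑ v ∈ level N k, (θ v ^ 2 + ∑ i ∈ Finset.range (N v),
            ∫⁻ y, g y ^ 2 * (θ (i :: v) ^ 2 / p (i :: v) y) ∂F) := Finset.sum_le_sum hstep
      _ = ∑ v ∈ level N k, θ v ^ 2 +
            ∫⁻ y, g y ^ 2 * ∑ w ∈ level N (k + 1), θ w ^ 2 / p w y ∂F := by
        rw [Finset.sum_add_distrib, ← sum_level_succ N k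
          (fun w => ∫⁻ y, g y ^ 2 * (θ w ^ 2 / p w y) ∂F), ← lintegral_finsetSum]
        · simp_rw [Finset.mul_sum]
        · exact fun w _ => (hg.pow_const 2).mul (measurable_const.div (hp w))
      _ ≤ C * ENNReal.ofReal ((m - 1) / (2 * m)) * (ENNReal.ofReal m ^ k)⁻¹ +
            ∫⁻ y, C * (ENNReal.ofReal m ^ (k + 1))⁻¹ * (t⁻¹ * t⁻¹) * s y ∂F := by
        refine add_le_add (henergy k) (lintegral_mono fun y => le_trans ?_ (hintg y))
        exact mul_le_mul_right (ih (k + 1) _) _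
      _ = C * (ENNReal.ofReal m ^ k)⁻¹ *
            ((ENNReal.ofReal m * t)⁻¹ + ENNReal.ofReal ((m - 1) / (2 * m))) := by
        rw [lintegral_const_mul _ hs, hst, pow_succ,
          ENNReal.mul_inv (Or.inr (by finiteness)) (Or.inr hmE),
          ENNReal.mul_inv (Or.inl hmE) (Or.inl (by finiteness))]
        rw [show C * ((ENNReal.ofReal m ^ k)⁻¹ * (ENNReal.ofReal m)⁻¹) * (t⁻¹ * t⁻¹) * t =
          C * ((ENNReal.ofReal m ^ k)⁻¹ * (ENNReal.ofReal m)⁻¹) * t⁻¹ * (t⁻¹ * t) by ring,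
          ENNReal.inv_mul_cancel ht0 htt]
        ring
      _ ≤ _ := by
        rw [div_eq_mul_inv, regularEscape, ← hc]
        exact mul_le_mul_right (inv_add_le_inv_one_sub_rpow_ennreal hm hlt) _

end Escape

/-! ### Resampling coordinates of a product measure -/

section Resample

variable {ι α : Type*} [DecidableEq ι] [MeasurableSpace α] (F : Measure α) [IsProbabilityMeasure F]

theorem infinitePi_map_update (i : ι) :
    ((Measure.infinitePi fun _ : ι => F).prod F).map (fun p => Function.update p.1 i p.2) =
      Measure.infinitePi fun _ : ι => F := by
  have hmeas : Measurable fun p : (ι → α) × α => Function.update p.1 i p.2 := measurable_update'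
  refine Measure.eq_infinitePi _ fun s t ht => ?_
  rw [Measure.map_apply hmeas (MeasurableSet.pi s.countable_toSet fun _ _ => ht _)]
  by_cases hi : i ∈ s
  · have : (fun p : (ι → α) × α => Function.update p.1 i p.2) ⁻¹' (s : Set ι).pi t =
        ((s.erase i : Finset ι) : Set ι).pi t ×ˢ t i := by
      ext ⟨x, y⟩
      simp only [Set.mem_preimage, Set.mem_pi, SetLike.mem_coe, Set.mem_prod, Finset.mem_erase]
      constructor
      · intro h
        exact ⟨fun j hj => by simpa [hj.1] using h j hj.2, by simpa using h i hi⟩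
      · rintro ⟨h1, h2⟩ j hj
        rcases eq_or_ne j i with rfl | hji
        · simpa using h2
        · simpa [hji] using h1 j ⟨hji, hj⟩
    rw [this, Measure.prod_prod, Measure.infinitePi_pi _ fun _ _ => ht _,
      Finset.prod_erase_mul _ _ hi]
  · have : (fun p : (ι → α) × α => Function.update p.1 i p.2) ⁻¹' (s : Set ι).pi t =
        (s : Set ι).pi t ×ˢ Set.univ := by
      ext ⟨x, y⟩
      simp only [Set.mem_preimage, Set.mem_pi, SetLike.mem_coe, Set.mem_prod, Set.mem_univ,
        and_true]
      refine forall₂_congr fun j hj => ?_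
      rw [Function.update_of_ne (fun h : j = i => hi (h ▸ hj))]
    rw [this, Measure.prod_prod, Measure.infinitePi_pi _ fun _ _ => ht _, measure_univ, mul_one]

theorem lintegral_infinitePi_update (i : ι) {f : (ι → α) → ℝ≥0∞} (hf : Measurable f) :
    ∫⁻ x, f x ∂(Measure.infinitePi fun _ : ι => F) =
      ∫⁻ x, ∫⁻ y, f (Function.update x i y) ∂F ∂(Measure.infinitePi fun _ : ι => F) := by
  have hmeas : Measurable fun p : (ι → α) × α => Function.update p.1 i p.2 := measurable_update'
  conv_lhs => rw [← infinitePi_map_update F i, lintegral_map hf hmeas]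
  exact lintegral_prod _ (hf.comp hmeas).aemeasurable

/-- If each factor of a product depends on one coordinate of its own, apart from coordinates that
no factor owns, then these coordinates may be integrated out factor by factor. -/
theorem lintegral_infinitePi_prod_update (s : Finset ι) {f : ι → (ι → α) → ℝ≥0∞}
    (hf : ∀ i, Measurable (f i))
    (hown : ∀ i ∈ s, ∀ j ∈ s, j ≠ i → ∀ x y, f i (Function.update x j y) = f i x) :
    ∫⁻ x, ∏ i ∈ s, f i x ∂(Measure.infinitePi fun _ : ι => F) =
      ∫⁻ x, ∏ i ∈ s, ∫⁻ y, f i (Function.update x i y) ∂F ∂(Measure.infinitePi fun _ : ι => F) := by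
  have hmeas : ∀ i, Measurable fun p : (ι → α) × α => Function.update p.1 i p.2 := fun i =>
    measurable_update'
  have hintg : ∀ i, Measurable fun x => ∫⁻ y, f i (Function.update x i y) ∂F := fun i =>
    ((hf i).comp (hmeas i)).lintegral_prod_right'
  suffices h : ∀ t ⊆ s, ∫⁻ x, ∏ i ∈ s, f i x ∂(Measure.infinitePi fun _ : ι => F) =
      ∫⁻ x, (∏ i ∈ s \ t, f i x) * ∏ i ∈ t, ∫⁻ y, f i (Function.update x i y) ∂F
        ∂(Measure.infinitePi fun _ : ι => F) by
    simpa using h s subset_rfl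
  intro t
  induction t using Finset.induction_on with
  | empty => simp
  | insert a t ha ih =>
    intro hts
    have has : a ∈ s := hts (Finset.mem_insert_self a t)
    have hts' : t ⊆ s := (Finset.subset_insert a t).trans hts
    rw [ih hts', lintegral_infinitePi_update F a]
    · refine lintegral_congr fun x => ?_
      have e1 : s \ t = insert a (s \ insert a t) := by
        ext i; by_cases h : i = a <;> simp_all
      have h2 : ∀ y, ∏ i ∈ s \ insert a t, f i (Function.update x a y) =
          ∏ i ∈ s \ insert a t, f i x := fun y => by
        refine Finset.prod_congr rfl fun i hi => ?_
        simp only [Finset.mem_sdiff, Finset.mem_insert, not_or] at hi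
        exact hown i hi.1 a has (Ne.symm hi.2.1) x y
      have h3 : ∀ y, ∏ i ∈ t, ∫⁻ z, f i (Function.update (Function.update x a y) i z) ∂F =
          ∏ i ∈ t, ∫⁻ z, f i (Function.update x i z) ∂F := fun y => by
        refine Finset.prod_congr rfl fun i hi => lintegral_congr fun z => ?_
        have hia : i ≠ a := fun h => ha (h ▸ hi)
        rw [Function.update_comm hia.symm, hown i (hts' hi) a has hia.symm]
      simp_rw [h3, e1]
      rw [Finset.prod_insert ha]
      simp_rw [Finset.prod_insert (show a ∉ s \ insert a t by simp), h2]
      have hm : Measurable fun y => f a (Function.update x a y) :=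
        (hf a).comp (measurable_update x)
      rw [lintegral_mul_const _ (hm.mul_const _), lintegral_mul_const _ hm]
      ring
    · exact (Finset.measurable_prod _ fun i _ => hf i).mul
        (Finset.measurable_prod _ fun i _ => hintg i)

end Resample

/-! ### The probability of hitting a target at a fixed level -/

/-- The labels `X(v₁), …, X(v)` on the path from the root to `v`, continued by zeros. -/
def pathLabels (X : List ℕ → ℝ) : List ℕ → ℕ → ℝ
  | [] => 0
  | i :: v => Function.update (pathLabels X v) v.length (X (i :: v))

theorem measurable_pathLabels (v : List ℕ) :
    Measurable fun X : List ℕ → ℝ => pathLabels X v := by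
  induction v with
  | nil => exact measurable_const
  | cons i v ih =>
    exact (measurable_update_pair v.length).comp (ih.prodMk (measurable_pi_apply _))

theorem pathLabels_update_of_length_lt (X : List ℕ → ℝ) {v w : List ℕ} (h : v.length < w.length)
    (y : ℝ) : pathLabels (Function.update X w y) v = pathLabels X v := by
  induction v with
  | nil => rfl
  | cons i v ih =>
    have hne : i :: v ≠ w := fun e => by simp [← e] at h
    rw [pathLabels, pathLabels, Function.update_of_ne hne, ih (by simp at h; omega)]

theorem pathLabels_update_of_ne (X : List ℕ → ℝ) {v w : List ℕ} (h : v.length = w.length)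
    (hne : v ≠ w) (y : ℝ) : pathLabels (Function.update X w y) v = pathLabels X v := by
  cases v with
  | nil => rfl
  | cons i v =>
    rw [pathLabels, pathLabels, Function.update_of_ne hne,
      pathLabels_update_of_length_lt X (by simp [← h])]

/-- The event that some vertex of level `n` is reached along labels in the target `D`. -/
def levelHit (N : List ℕ → ℕ) (D : Set (ℕ → ℝ)) (n : ℕ) : Set (List ℕ → ℝ) :=
  {X | ∃ v ∈ level N n, pathLabels X v ∈ D}

section LevelHit

variable (N : List ℕ → ℕ) {F : Measure ℝ} [IsProbabilityMeasure F] {D : Set (ℕ → ℝ)}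

theorem measurableSet_levelHit (hD : MeasurableSet D) (n : ℕ) :
    MeasurableSet (levelHit N D n) := by
  have : levelHit N D n = ⋃ v ∈ level N n, {X | pathLabels X v ∈ D} := by
    ext X; simp [levelHit]
  rw [this]
  exact Finset.measurableSet_biUnion _ fun v _ => measurable_pathLabels v hD

theorem lintegral_prod_escape (hD : MeasurableSet D) (j k : ℕ) :
    ∫⁻ X, ∏ v ∈ level N k, escape N F D j v (pathLabels X v)
        ∂(Measure.infinitePi fun _ : List ℕ => F) =
      escape N F D (j + k) [] 0 := by
  induction k generalizing j with
  | zero => simp [level, pathLabels]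
  | succ k ih =>
    rw [lintegral_infinitePi_prod_update F (level N (k + 1))
      (f := fun v X => escape N F D j v (pathLabels X v))
      (fun v => (measurable_escape hD j v).comp (measurable_pathLabels v))]
    · rw [show j + (k + 1) = j + 1 + k by ring, ← ih (j + 1)]
      refine lintegral_congr fun X => ?_
      rw [prod_level_succ]
      refine Finset.prod_congr rfl fun v _ => Finset.prod_congr rfl fun i _ => ?_
      refine lintegral_congr fun y => ?_
      rw [pathLabels, Function.update_self, pathLabels_update_of_length_lt X (by simp)]
    · intro v hv w hw hne X y
      rw [pathLabels_update_of_ne X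
        ((length_of_mem_level hv).trans (length_of_mem_level hw).symm) hne.symm]

theorem infinitePi_levelHit (hD : MeasurableSet D) (n : ℕ) :
    Measure.infinitePi (fun _ : List ℕ => F) (levelHit N D n) = 1 - escape N F D n [] 0 := by
  have h := lintegral_prod_escape N (F := F) hD 0 n
  rw [zero_add] at h
  have h2 : (fun X => ∏ v ∈ level N n, escape N F D 0 v (pathLabels X v)) =
      (levelHit N D n)ᶜ.indicator 1 := by
    funext X
    by_cases hX : X ∈ levelHit N D n
    · obtain ⟨v, hv, hvD⟩ := id hX
      rw [Set.indicator_of_notMem (by simpa using hX)]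
      exact Finset.prod_eq_zero hv (by simp [escape, hvD])
    · rw [Set.indicator_of_mem hX]
      refine Finset.prod_eq_one fun v hv => ?_
      have : pathLabels X v ∉ D := fun hvD => hX ⟨v, hv, hvD⟩
      simp [escape, this]
  have hm := measurableSet_levelHit N hD n
  rw [h2, lintegral_indicator_one hm.compl] at h
  rw [← h, prob_compl_eq_one_sub hm, ENNReal.sub_sub_cancel ENNReal.one_ne_top prob_le_one]

/-- A tree whose levels grow like `m ^ k` and a tree that carries a flow with the energy of the
uniform flow on an `m`-ary tree are comparable at each level, uniformly in the level, the target and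
the law of the labels. -/
theorem infinitePi_levelHit_le {N N' : List ℕ → ℕ} {m A : ℝ} (hm : 1 < m) (hA : 1 ≤ A)
    (hN : ∀ k, ((level N k).card : ℝ) ≤ A * m ^ k) {C : ℝ≥0∞} (hC : C ≠ 0) (hC' : C ≠ ∞)
    {θ : List ℕ → ℝ≥0∞} (hθ : ∀ v, θ v ≠ ∞) (hθ0 : θ [] ≠ 0)
    (hflow : ∀ v, θ v ≤ ∑ i ∈ Finset.range (N' v), θ (i :: v))
    (henergy : ∀ k, ∑ v ∈ level N' k, θ v ^ 2 ≤
      C * ENNReal.ofReal ((m - 1) / (2 * m)) * (ENNReal.ofReal m ^ k)⁻¹)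
    (hD : MeasurableSet D) (n : ℕ) :
    Measure.infinitePi (fun _ : List ℕ => F) (levelHit N D n) ≤
      ENNReal.ofReal A * (C / θ [] ^ 2) *
        Measure.infinitePi (fun _ : List ℕ => F) (levelHit N' D n) := by
  rw [infinitePi_levelHit N hD, infinitePi_levelHit N' hD]
  have h1 := regularEscape_rpow_le_prod_escape (F := F) (lt_of_lt_of_le one_pos hA)
    (one_pos.trans hm) hN hD n 0 0
  have h2 := sum_sq_div_escape_le (F := F) hm hC hθ hflow henergy hD n 0 0
  simp only [level, Finset.prod_singleton, Finset.sum_singleton, pow_zero, mul_one,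
    inv_one] at h1 h2
  set s := 1 - regularEscape m F D n 0 0
  set p := 1 - escape N' F D n [] 0
  have hs : s ≠ ∞ := (tsub_le_self.trans_lt ENNReal.one_lt_top).ne
  have hp : p ≠ ∞ := (tsub_le_self.trans_lt ENNReal.one_lt_top).ne
  have h3 : 1 - escape N F D n [] 0 ≤ ENNReal.ofReal A * s :=
    (tsub_le_tsub_left h1 1).trans
      (one_sub_rpow_le_mul hA (regularEscape_le_one (by linarith) _ _ _))
  refine h3.trans ?_
  rw [mul_assoc]
  refine mul_le_mul_right ?_ _
  rcases eq_or_ne s 0 with hs0 | hs0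
  · simp [hs0]
  have hp0 : p ≠ 0 := by
    intro h
    rw [h, ENNReal.div_zero (pow_ne_zero 2 hθ0), top_le_iff] at h2
    exact ENNReal.div_ne_top hC' hs0 h2
  have hθ2 : θ [] ^ 2 ≠ 0 := pow_ne_zero 2 hθ0
  have hθ2' : θ [] ^ 2 ≠ ∞ := ENNReal.pow_ne_top (hθ [])
  rw [ENNReal.div_le_iff hp0 hp, div_eq_mul_inv, mul_right_comm, ← div_eq_mul_inv,
    ENNReal.le_div_iff_mul_le (Or.inl hs0) (Or.inl hs)] at h2
  rw [div_eq_mul_inv, mul_right_comm, ← div_eq_mul_inv,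
    ENNReal.le_div_iff_mul_le (Or.inl hθ2) (Or.inl hθ2'), mul_comm]
  exact h2

end LevelHit

/-! ### Passage to infinite paths -/

/-- The sequences whose first `n` terms are approximated by those of elements of `B`. -/
def prefixClosure (B : Set (ℕ → ℝ)) (n : ℕ) : Set (ℕ → ℝ) :=
  {x | (fun i : Fin n => x i) ∈ closure ((fun (b : ℕ → ℝ) (i : Fin n) => b i) '' B)}

theorem measurableSet_prefixClosure (B : Set (ℕ → ℝ)) (n : ℕ) :
    MeasurableSet (prefixClosure B n) :=
  (isClosed_closure.preimage (f := fun (x : ℕ → ℝ) (i : Fin n) => x i)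
    (by fun_prop)).measurableSet

theorem prefixClosure_congr {B : Set (ℕ → ℝ)} {n : ℕ} {x y : ℕ → ℝ} (h : ∀ i < n, x i = y i) :
    x ∈ prefixClosure B n ↔ y ∈ prefixClosure B n := by
  have : (fun i : Fin n => x i) = fun i : Fin n => y i := funext fun i => h i i.2
  simp only [prefixClosure, Set.mem_ofPred_eq, this]

theorem subset_prefixClosure (B : Set (ℕ → ℝ)) (n : ℕ) : B ⊆ prefixClosure B n := fun x hx =>
  subset_closure ⟨x, hx, rfl⟩

theorem prefixClosure_anti (B : Set (ℕ → ℝ)) : Antitone (prefixClosure B) := by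
  intro n k hnk x hx
  have hc : Continuous fun (y : Fin k → ℝ) (i : Fin n) => y (Fin.castLE hnk i) := by fun_prop
  have := image_closure_subset_closure_image hc ⟨_, hx, rfl⟩
  rw [Set.image_image] at this
  exact this

theorem mem_closure_of_forall_mem_prefixClosure {B : Set (ℕ → ℝ)} {x : ℕ → ℝ}
    (h : ∀ n, x ∈ prefixClosure B n) : x ∈ closure B := by
  rw [mem_closure_iff_nhds]
  intro U hU
  rw [nhds_pi, Filter.mem_pi'] at hU
  obtain ⟨I, t, ht, hsub⟩ := hU
  obtain ⟨n, hn⟩ : ∃ n, ∀ i ∈ I, i < n := ⟨I.sup id + 1, fun i hi =>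
    Nat.lt_succ_of_le (Finset.le_sup (f := id) hi)⟩
  have hV : {y : Fin n → ℝ | ∀ i : Fin n, (i : ℕ) ∈ I → y i ∈ t i} ∈
      nhds (fun i : Fin n => x i) := by
    have : {y : Fin n → ℝ | ∀ i : Fin n, (i : ℕ) ∈ I → y i ∈ t i} =
        Set.pi {i : Fin n | (i : ℕ) ∈ I} fun i => t i := by ext y; simp [Set.mem_pi]
    rw [this]
    exact set_pi_mem_nhds (Set.toFinite _) fun i _ => ht i
  obtain ⟨_, hy, b, hb, rfl⟩ := mem_closure_iff_nhds.1 (h n) _ hV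
  exact ⟨b, hsub fun i hi => hy ⟨i, hn i hi⟩ hi, hb⟩

theorem length_pathVertex (ξ : ℕ → ℕ) (n : ℕ) : (pathVertex ξ n).length = n := by
  induction n with
  | zero => rfl
  | succ n ih => simp [pathVertex, ih]

theorem pathLabels_append (X : List ℕ → ℝ) (w v : List ℕ) {i : ℕ} (hi : i < v.length) :
    pathLabels X (w ++ v) i = pathLabels X v i := by
  induction w with
  | nil => rfl
  | cons a w ih =>
    rw [List.cons_append, pathLabels, Function.update_of_ne (by simp; omega), ih]

theorem memOffspring_of_append {N : List ℕ → ℕ} {w v : List ℕ} (h : MemOffspring N (w ++ v)) :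
    MemOffspring N v := by
  induction w with
  | nil => exact h
  | cons a w ih => exact ih h.1

theorem pathLabels_pathVertex (X : List ℕ → ℝ) (ξ : ℕ → ℕ) {i n : ℕ} (hi : i < n) :
    pathLabels X (pathVertex ξ n) i = X (pathVertex ξ (i + 1)) := by
  induction n with
  | zero => omega
  | succ n ih =>
    rw [pathVertex, pathLabels, length_pathVertex]
    rcases eq_or_ne i n with rfl | h
    · rw [Function.update_self, pathVertex]
    · rw [Function.update_of_ne h, ih (by omega)]

/-- The event `hitEvent (ofOffspring N) B` for labels that are attached to all words. -/
def pathHit (N : List ℕ → ℕ) (B : Set (ℕ → ℝ)) : Set (List ℕ → ℝ) :=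
  {X | ∃ ξ ∈ (ofOffspring N).boundary, (fun n => X (pathVertex ξ (n + 1))) ∈ B}

/-- A vertex lies on arbitrarily long finite paths that are compatible with the target `B`. -/
def IsPromising (N : List ℕ → ℕ) (B : Set (ℕ → ℝ)) (X : List ℕ → ℝ) (v : List ℕ) : Prop :=
  ∀ n, ∃ w : List ℕ, w.length = n ∧ MemOffspring N (w ++ v) ∧
    pathLabels X (w ++ v) ∈ prefixClosure B (n + v.length)

theorem IsPromising.exists_child {N : List ℕ → ℕ} {B : Set (ℕ → ℝ)} {X : List ℕ → ℝ}
    {v : List ℕ} (h : IsPromising N B X v) : ∃ i, IsPromising N B X (i :: v) := by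
  by_contra! hcon
  simp only [IsPromising, not_forall] at hcon
  choose n hn using hcon
  obtain ⟨w, hwl, hw, hwB⟩ := h ((Finset.range (N v)).sup n + 1)
  obtain ⟨a, i, rfl⟩ : ∃ a i, w = a ++ [i] := by
    rcases List.eq_nil_or_concat w with rfl | ⟨a, i, rfl⟩
    · simp at hwl
    · exact ⟨a, i, by simp⟩
  have hi : i < N v := (memOffspring_of_append (w := a) (by simpa using hw) :
    MemOffspring N (i :: v)).2
  have hni : n i ≤ a.length := by
    have := Finset.le_sup (f := n) (Finset.mem_range.2 hi)
    simp at hwl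
    omega
  refine hn i ⟨a.drop (a.length - n i), by simp; omega, ?_, ?_⟩
  · refine memOffspring_of_append (w := a.take (a.length - n i)) ?_
    rw [← List.append_assoc, List.take_append_drop]
    simpa using hw
  · have h1 := prefixClosure_anti B (show n i + (i :: v).length ≤
        (Finset.range (N v)).sup n + 1 + v.length by
      have := Finset.le_sup (f := n) (Finset.mem_range.2 hi)
      simp; omega) hwB
    refine (prefixClosure_congr fun k hk => ?_).1 h1
    have h2 := pathLabels_append X (a.take (a.length - n i)) (a.drop (a.length - n i) ++ i :: v)
      (i := k) (by simp at hk ⊢; omega)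
    rw [← List.append_assoc, List.take_append_drop] at h2
    simpa using h2

/-- By Kőnig's lemma, some infinite path has its labels in the closed set `B` as soon as there are
finite paths of all lengths that come arbitrarily close to doing so. -/
theorem pathHit_eq_iInter (N : List ℕ → ℕ) {B : Set (ℕ → ℝ)} (hB : IsClosed B) :
    pathHit N B = ⋂ n, levelHit N (prefixClosure B n) n := by
  ext X
  rw [Set.mem_iInter]
  constructor
  · rintro ⟨ξ, hξ, hX⟩ n
    refine ⟨pathVertex ξ n, mem_level.2 ⟨length_pathVertex ξ n, hξ n⟩, ?_⟩
    refine (prefixClosure_congr fun i hi => ?_).1 (subset_prefixClosure B n hX)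
    rw [pathLabels_pathVertex X ξ hi]
  · intro h
    have hroot : IsPromising N B X [] := fun n => by
      obtain ⟨v, hv, hvB⟩ := h n
      obtain ⟨hl, hm⟩ := mem_level.1 hv
      exact ⟨v, hl, by simpa using hm, by simpa using hvB⟩
    choose c hc using fun v : {v // IsPromising N B X v} => v.2.exists_child
    let f : ℕ → {v // IsPromising N B X v} :=
      fun n => Nat.rec ⟨[], hroot⟩ (fun _ v => ⟨c v :: v.1, hc v⟩) n
    have hf : ∀ n, pathVertex (fun n => c (f n)) n = (f n).1 := by
      intro n
      induction n with
      | zero => rfl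
      | succ n ih => rw [pathVertex, ih]
    have hmem : ∀ n, MemOffspring N (pathVertex (fun n => c (f n)) n) ∧
        pathLabels X (pathVertex (fun n => c (f n)) n) ∈ prefixClosure B n := fun n => by
      obtain ⟨w, hw, h1, h2⟩ := (f n).2 0
      rw [List.length_eq_zero_iff] at hw
      subst hw
      rw [hf n]
      refine ⟨by simpa using h1, ?_⟩
      have hl : (f n).1.length = n := by rw [← hf n, length_pathVertex]
      simpa [hl] using h2
    refine ⟨fun n => c (f n), fun n => (hmem n).1, ?_⟩
    rw [← hB.closure_eq]
    refine mem_closure_of_forall_mem_prefixClosure fun n => ?_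
    refine (prefixClosure_congr fun i hi => ?_).1 (hmem n).2
    rw [pathLabels_pathVertex X _ hi]

theorem levelHit_prefixClosure_anti (N : List ℕ → ℕ) (B : Set (ℕ → ℝ)) :
    Antitone fun n => levelHit N (prefixClosure B n) n := by
  refine antitone_nat_of_succ_le fun n X hX => ?_
  obtain ⟨v, hv, hvB⟩ := hX
  obtain ⟨hl, hm⟩ := mem_level.1 hv
  cases v with
  | nil => simp at hl
  | cons i v =>
    have hl' : v.length = n := by simpa using hl
    refine ⟨v, mem_level.2 ⟨hl', hm.1⟩, ?_⟩
    refine (prefixClosure_congr fun k hk => ?_).1 (prefixClosure_anti B n.le_succ hvB)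
    rw [pathLabels, Function.update_of_ne (by omega)]

theorem hitProb_ofOffspring (N : List ℕ → ℕ) {B : Set (ℕ → ℝ)} (hB : IsClosed B)
    (F : ProbabilityMeasure ℝ) :
    (ofOffspring N).hitProb B F =
      Measure.infinitePi (fun _ : List ℕ => (F : Measure ℝ)) (pathHit N B) := by
  classical
  have hmeas : MeasurableSet (pathHit N B) := by
    rw [pathHit_eq_iInter N hB]
    exact MeasurableSet.iInter fun n =>
      measurableSet_levelHit N (measurableSet_prefixClosure B n) n
  let ext : ((ofOffspring N).verts → ℝ) → List ℕ → ℝ := fun Y v =>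
    if h : v ∈ (ofOffspring N).verts then Y ⟨v, h⟩ else 0
  have hext : Measurable ext := by
    refine measurable_pi_lambda _ fun v => ?_
    by_cases h : v ∈ (ofOffspring N).verts
    · simpa [ext, h] using measurable_pi_apply _
    · simp [ext, h]
  have h1 : (ofOffspring N).hitEvent B = ext ⁻¹' pathHit N B := by
    ext Y
    constructor
    · rintro ⟨ξ, hξ⟩
      refine ⟨ξ.1, ξ.2, ?_⟩
      convert! hξ using 1
      funext n
      simp only [ext, dif_pos (ξ.2 (n + 1)), labelsAlong]
    · rintro ⟨ξ, hξ, hB⟩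
      refine ⟨⟨ξ, hξ⟩, ?_⟩
      convert! hB using 1
      funext n
      simp only [ext, dif_pos (hξ (n + 1)), labelsAlong]
  have h2 : (ofOffspring N).verts.domRestrict ⁻¹' ((ofOffspring N).hitEvent B) = pathHit N B := by
    ext X
    constructor
    · rintro ⟨ξ, hξ⟩
      exact ⟨ξ.1, ξ.2, hξ⟩
    · rintro ⟨ξ, hξ, hB⟩
      exact ⟨⟨ξ, hξ⟩, hB⟩
  rw [hitProb, ← Measure.infinitePi_map_restrict' (fun _ : List ℕ => (F : Measure ℝ)),
    Measure.map_apply (by fun_prop) (h1 ▸ hext hmeas), h2]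

theorem hitProb_le {N N' : List ℕ → ℕ} {B : Set (ℕ → ℝ)} (hB : IsClosed B)
    (F : ProbabilityMeasure ℝ) {K : ℝ≥0∞} (hK : K ≠ ∞)
    (h : ∀ n, Measure.infinitePi (fun _ : List ℕ => (F : Measure ℝ))
        (levelHit N (prefixClosure B n) n) ≤
      K * Measure.infinitePi (fun _ : List ℕ => (F : Measure ℝ))
        (levelHit N' (prefixClosure B n) n)) :
    (ofOffspring N).hitProb B F ≤ K * (ofOffspring N').hitProb B F := by
  have hlim : ∀ N : List ℕ → ℕ, Filter.Tendsto
      (fun n => Measure.infinitePi (fun _ : List ℕ => (F : Measure ℝ))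
        (levelHit N (prefixClosure B n) n)) Filter.atTop
      (nhds ((ofOffspring N).hitProb B F)) := fun N => by
    rw [hitProb_ofOffspring N hB, pathHit_eq_iInter N hB]
    exact tendsto_measure_iInter_atTop
      (fun n => (measurableSet_levelHit N (measurableSet_prefixClosure B n) n).nullMeasurableSet)
      (levelHit_prefixClosure_anti N B) ⟨0, measure_ne_top _ _⟩
  exact le_of_tendsto_of_tendsto' (hlim N)
    (ENNReal.Tendsto.const_mul (hlim N') (Or.inr hK)) h

/-! ### The branching property -/

/-- The offspring numbers in the subtree at the vertex `v`. -/
def shift (v : List ℕ) (N : List ℕ → ℕ) : List ℕ → ℕ := fun w => N (w ++ v)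

theorem measurable_shift (v : List ℕ) : Measurable (shift v) :=
  measurable_pi_lambda _ fun w => measurable_pi_apply (w ++ v)

/-- The sum of a functional of trees over the subtrees at the children of the root. -/
def branchSum {M : Type*} [AddCommMonoid M] (g : (List ℕ → ℕ) → M) (N : List ℕ → ℕ) : M :=
  ∑ i ∈ Finset.range (N []), g (shift [i] N)

/-- The `k`-th iterate of `branchSum` sums over the subtrees at the vertices of level `k`. -/
theorem sum_level_shift {M : Type*} [AddCommMonoid M] (g : (List ℕ → ℕ) → M) (k : ℕ)
    (N : List ℕ → ℕ) : ∑ v ∈ level N k, g (shift v N) = branchSum^[k] g N := by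
  induction k generalizing g with
  | zero =>
    simp only [level, Finset.sum_singleton, Function.iterate_zero, id]
    congr 1
    funext w
    simp [shift]
  | succ k ih =>
    rw [sum_level_succ, Function.iterate_succ_apply, ← ih]
    refine Finset.sum_congr rfl fun v _ => Finset.sum_congr (by rfl) fun i _ => ?_
    congr 1
    funext w
    simp [shift]

theorem measurable_root_pair : Measurable fun N : List ℕ → ℕ => (N [], N) :=
  (measurable_pi_apply ([] : List ℕ)).prodMk measurable_id

theorem measurable_branchSum {M : Type*} [AddCommMonoid M] [MeasurableSpace M] [MeasurableAdd₂ M]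
    {g : (List ℕ → ℕ) → M} (hg : Measurable g) : Measurable (branchSum g) := by
  have h : Measurable fun p : ℕ × (List ℕ → ℕ) => ∑ i ∈ Finset.range p.1, g (shift [i] p.2) :=
    measurable_from_prod_countable_right fun n =>
      Finset.measurable_sum (Finset.range n) fun i _ =>
        (hg.comp (measurable_shift [i]) : Measurable fun N => g (shift [i] N))
  exact h.comp measurable_root_pair

theorem measurable_iterate_branchSum {M : Type*} [AddCommMonoid M] [MeasurableSpace M]
    [MeasurableAdd₂ M] {g : (List ℕ → ℕ) → M} (hg : Measurable g) (k : ℕ) :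
    Measurable (branchSum^[k] g) := by
  induction k with
  | zero => exact hg
  | succ k ih => rw [Function.iterate_succ_apply']; exact measurable_branchSum ih

theorem shift_update_nil (i : ℕ) (N : List ℕ → ℕ) (n : ℕ) :
    shift [i] (Function.update N [] n) = shift [i] N := by
  funext w
  rw [shift, Function.update_of_ne (by simp), shift]

/-- The law of IID offspring numbers with distribution `q`, attached to all words. -/
noncomputable def offspringLaw (q : PMF ℕ) : Measure (List ℕ → ℕ) :=
  Measure.infinitePi fun _ : List ℕ => q.toMeasure

instance (q : PMF ℕ) : IsProbabilityMeasure (offspringLaw q) := by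
  rw [offspringLaw]; infer_instance

section OffspringLaw

variable (q : PMF ℕ)

theorem measurePreserving_shift (v : List ℕ) :
    MeasurePreserving (shift v) (offspringLaw q) (offspringLaw q) :=
  ⟨measurable_shift v, Measure.map_infinitePi_infinitePi_of_inj
    (P := fun _ : List ℕ => q.toMeasure) (List.append_left_injective v)⟩

theorem lintegral_shift (v : List ℕ) {g : (List ℕ → ℕ) → ℝ≥0∞} (hg : Measurable g) :
    ∫⁻ N, g (shift v N) ∂offspringLaw q = ∫⁻ N, g N ∂offspringLaw q :=
  (measurePreserving_shift q v).lintegral_comp hg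

theorem iIndepFun_shift :
    ProbabilityTheory.iIndepFun (fun (i : ℕ) => shift [i]) (offspringLaw q) := by
  rw [ProbabilityTheory.iIndepFun_iff_map_fun_eq_infinitePi_map fun i => measurable_shift [i]]
  simp_rw [(measurePreserving_shift q _).map_eq]
  have hinj : Function.Injective fun p : ℕ × List ℕ => p.2 ++ [p.1] := by
    rintro ⟨i, v⟩ ⟨j, w⟩ h
    simpa [and_comm] using h
  have h1 := Measure.map_infinitePi_infinitePi_of_inj (P := fun _ : List ℕ => q.toMeasure) hinj
  have h2 := Measure.infinitePi_map_curry (ι := ℕ) (κ := List ℕ) fun _ _ => q.toMeasure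
  rw [← h1, Measure.map_map (by fun_prop) (by fun_prop)] at h2
  exact h2

/-- The number of children of the root is independent of the subtrees at its children. -/
theorem lintegral_root {f : ℕ → (List ℕ → ℕ) → ℝ≥0∞} (hf : ∀ n, Measurable (f n))
    (hroot : ∀ n N k, f n (Function.update N [] k) = f n N) :
    ∫⁻ N, f (N []) N ∂offspringLaw q = ∑' n, (∫⁻ N, f n N ∂offspringLaw q) * q n := by
  have hf' : Measurable fun p : ℕ × (List ℕ → ℕ) => f p.1 p.2 :=
    measurable_from_prod_countable_right hf
  have hm : Measurable fun N : List ℕ → ℕ => f (N []) N :=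
    hf'.comp measurable_root_pair
  rw [offspringLaw, lintegral_infinitePi_update q.toMeasure [] hm]
  simp_rw [Function.update_self, hroot, lintegral_countable',
    PMF.toMeasure_apply_singleton q _ (MeasurableSet.singleton _)]
  rw [lintegral_tsum fun n => ((hf n).mul_const _).aemeasurable]
  simp_rw [lintegral_mul_const _ (hf _)]

variable {q} {m : ℝ}

theorem lintegral_branchSum (hmean : ∑' n : ℕ, (n : ℝ≥0∞) * q n = ENNReal.ofReal m)
    {g : (List ℕ → ℕ) → ℝ≥0∞} (hg : Measurable g) :
    ∫⁻ N, branchSum g N ∂offspringLaw q = ENNReal.ofReal m * ∫⁻ N, g N ∂offspringLaw q := by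
  have hgi : ∀ i, Measurable fun N => g (shift [i] N) := fun i => hg.comp (measurable_shift [i])
  have h := lintegral_root q (f := fun n N => ∑ i ∈ Finset.range n, g (shift [i] N))
    (fun n => Finset.measurable_sum _ fun i _ => hgi i)
    (fun n N k => by simp_rw [shift_update_nil])
  simp_rw [branchSum, h]
  rw [← hmean, ← ENNReal.tsum_mul_right]
  congr 1 with n
  rw [lintegral_finsetSum _ fun i _ => hgi i]
  simp_rw [lintegral_shift q _ hg]
  simp only [Finset.sum_const, Finset.card_range, nsmul_eq_mul]
  ring

theorem lintegral_iterate_branchSum (hmean : ∑' n : ℕ, (n : ℝ≥0∞) * q n = ENNReal.ofReal m)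
    {g : (List ℕ → ℕ) → ℝ≥0∞} (hg : Measurable g) (k : ℕ) :
    ∫⁻ N, branchSum^[k] g N ∂offspringLaw q = ENNReal.ofReal m ^ k * ∫⁻ N, g N ∂offspringLaw q := by
  induction k with
  | zero => simp
  | succ k ih =>
    rw [Function.iterate_succ_apply', lintegral_branchSum hmean (measurable_iterate_branchSum hg k),
      ih, pow_succ]
    ring

theorem memLp_two_of_lintegral {μ : Measure (List ℕ → ℕ)} {g : (List ℕ → ℕ) → ℝ}
    (hg : Measurable g) (h : ∫⁻ N, ‖g N‖ₑ ^ 2 ∂μ < ∞) : MemLp g 2 μ := by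
  refine ⟨hg.aestronglyMeasurable, ?_⟩
  rw [eLpNorm_lt_top_iff_lintegral_rpow_enorm_lt_top (by simp) (by simp)]
  simpa using h

/-- Sums over the children of a centred functional of the subtrees are orthogonal, so that second
moments are multiplied by the mean number of children. -/
theorem lintegral_sq_branchSum (hmean : ∑' n : ℕ, (n : ℝ≥0∞) * q n = ENNReal.ofReal m)
    {g : (List ℕ → ℕ) → ℝ} (hg : Measurable g) (h2 : ∫⁻ N, ‖g N‖ₑ ^ 2 ∂offspringLaw q < ∞)
    (h0 : ∫ N, g N ∂offspringLaw q = 0) :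
    ∫⁻ N, ‖branchSum g N‖ₑ ^ 2 ∂offspringLaw q =
        ENNReal.ofReal m * ∫⁻ N, ‖g N‖ₑ ^ 2 ∂offspringLaw q ∧
      ∫ N, branchSum g N ∂offspringLaw q = 0 := by
  have hgi : ∀ i, Measurable fun N => g (shift [i] N) := fun i => hg.comp (measurable_shift [i])
  have hLp : MemLp g 2 (offspringLaw q) := memLp_two_of_lintegral hg h2
  have hLpi : ∀ i, MemLp (fun N => g (shift [i] N)) 2 (offspringLaw q) := fun i =>
    hLp.comp_measurePreserving (measurePreserving_shift q [i])
  have h0i : ∀ i, ∫ N, g (shift [i] N) ∂offspringLaw q = 0 := fun i => by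
    rw [← h0, ← (measurePreserving_shift q [i]).map_eq,
      integral_map (measurable_shift [i]).aemeasurable hg.aestronglyMeasurable,
      (measurePreserving_shift q [i]).map_eq]
  have h0n : ∀ n, ∫ N, ∑ i ∈ Finset.range n, g (shift [i] N) ∂offspringLaw q = 0 := fun n => by
    rw [integral_finsetSum _ fun i _ => (hLpi i).integrable one_le_two]
    simp [h0i]
  have hvar : ∀ n, ∫⁻ N, ‖∑ i ∈ Finset.range n, g (shift [i] N)‖ₑ ^ 2 ∂offspringLaw q =
      n * ∫⁻ N, ‖g N‖ₑ ^ 2 ∂offspringLaw q := by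
    intro n
    have hv := ProbabilityTheory.IndepFun.variance_sum (μ := offspringLaw q)
      (s := Finset.range n) (X := fun i N => g (shift [i] N)) (fun i _ => hLpi i)
      (fun i _ j _ hij => ((iIndepFun_shift q).indepFun hij).comp hg hg)
    have e : ∀ i, ENNReal.ofReal (ProbabilityTheory.variance (fun N => g (shift [i] N))
        (offspringLaw q)) = ∫⁻ N, ‖g N‖ₑ ^ 2 ∂offspringLaw q := fun i => by
      rw [ProbabilityTheory.ofReal_variance (hLpi i), ProbabilityTheory.evariance, h0i i]
      simp_rw [sub_zero]
      exact lintegral_shift q [i] (g := fun N => ‖g N‖ₑ ^ 2) (by fun_prop)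
    have hS : MemLp (∑ i ∈ Finset.range n, fun N => g (shift [i] N)) 2 (offspringLaw q) :=
      memLp_finsetSum' _ fun i _ => hLpi i
    have h := ProbabilityTheory.ofReal_variance hS
    rw [hv, ENNReal.ofReal_sum_of_nonneg fun i _ => ProbabilityTheory.variance_nonneg _ _] at h
    simp_rw [e] at h
    rw [ProbabilityTheory.evariance] at h
    simp only [Finset.sum_apply, h0n n, sub_zero, Finset.sum_const, Finset.card_range,
      nsmul_eq_mul] at h
    exact h.symm
  have hsq : ∫⁻ N, ‖branchSum g N‖ₑ ^ 2 ∂offspringLaw q =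
      ENNReal.ofReal m * ∫⁻ N, ‖g N‖ₑ ^ 2 ∂offspringLaw q := by
    have h := lintegral_root q (f := fun n N => ‖∑ i ∈ Finset.range n, g (shift [i] N)‖ₑ ^ 2)
      (fun n => (Finset.measurable_sum _ fun i _ => hgi i).enorm.pow_const 2)
      (fun n N k => by simp_rw [shift_update_nil])
    simp_rw [branchSum, h, hvar]
    rw [← hmean, ← ENNReal.tsum_mul_right]
    congr 1 with n
    ring
  refine ⟨hsq, ?_⟩
  have hB : Measurable (branchSum g) := measurable_branchSum hg
  have hBLp : MemLp (branchSum g) 2 (offspringLaw q) := memLp_two_of_lintegral hB (by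
    rw [hsq]; exact ENNReal.mul_lt_top ENNReal.ofReal_lt_top h2)
  have hmeas : Measurable fun p : (List ℕ → ℕ) × ℕ => Function.update p.1 [] p.2 :=
    measurable_update'
  have hmap := infinitePi_map_update q.toMeasure ([] : List ℕ)
  have hintg := hBLp.integrable one_le_two
  rw [offspringLaw, ← hmap] at hintg
  rw [offspringLaw, ← hmap, integral_map hmeas.aemeasurable hB.aestronglyMeasurable,
    integral_prod_symm (fun p : (List ℕ → ℕ) × ℕ => branchSum g (Function.update p.1 [] p.2))
      (hintg.comp_measurable hmeas)]
  simp_rw [branchSum, Function.update_self, shift_update_nil]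
  rw [← offspringLaw]
  simp_rw [h0n, integral_zero]

theorem lintegral_sq_iterate_branchSum
    (hmean : ∑' n : ℕ, (n : ℝ≥0∞) * q n = ENNReal.ofReal m)
    {g : (List ℕ → ℕ) → ℝ} (hg : Measurable g) (h2 : ∫⁻ N, ‖g N‖ₑ ^ 2 ∂offspringLaw q < ∞)
    (h0 : ∫ N, g N ∂offspringLaw q = 0) (k : ℕ) :
    ∫⁻ N, ‖branchSum^[k] g N‖ₑ ^ 2 ∂offspringLaw q =
      ENNReal.ofReal m ^ k * ∫⁻ N, ‖g N‖ₑ ^ 2 ∂offspringLaw q := by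
  suffices h : ∫⁻ N, ‖branchSum^[k] g N‖ₑ ^ 2 ∂offspringLaw q =
      ENNReal.ofReal m ^ k * ∫⁻ N, ‖g N‖ₑ ^ 2 ∂offspringLaw q ∧
      ∫ N, branchSum^[k] g N ∂offspringLaw q = 0 from h.1
  induction k with
  | zero => simpa using h0
  | succ k ih =>
    obtain ⟨h3, h4⟩ := lintegral_sq_branchSum hmean (measurable_iterate_branchSum hg k)
      (by rw [ih.1]; exact ENNReal.mul_lt_top (by finiteness) h2) ih.2
    rw [Function.iterate_succ_apply']
    refine ⟨?_, h4⟩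
    rw [h3, ih.1, pow_succ]
    ring

end OffspringLaw

/-! ### Normalised level sizes -/

/-- The size of level `n`, divided by `m ^ n`. -/
noncomputable def levelRatio (m : ℝ) (n : ℕ) (N : List ℕ → ℕ) : ℝ≥0∞ :=
  (ENNReal.ofReal m ^ n)⁻¹ * branchSum^[n] (fun _ => (1 : ℝ≥0∞)) N

/-- The asymptotic size of a tree relative to `m ^ n`. The upper limit is used because it is
subadditive over the subtrees at the children of the root without any proof of convergence. -/
noncomputable def limitRatio (m : ℝ) (N : List ℕ → ℕ) : ℝ≥0∞ :=
  Filter.limsup (fun n => levelRatio m n N) Filter.atTop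

theorem measurable_levelRatio (m : ℝ) (n : ℕ) : Measurable (levelRatio m n) :=
  (measurable_iterate_branchSum measurable_const n).const_mul _

theorem measurable_limitRatio (m : ℝ) : Measurable (limitRatio m) :=
  Measurable.limsup fun n => measurable_levelRatio m n

theorem levelRatio_zero (m : ℝ) (N : List ℕ → ℕ) : levelRatio m 0 N = 1 := by
  simp [levelRatio]

theorem levelRatio_eq_card (m : ℝ) (n : ℕ) (N : List ℕ → ℕ) :
    levelRatio m n N = (ENNReal.ofReal m ^ n)⁻¹ * (level N n).card := by
  rw [levelRatio, ← sum_level_shift]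
  simp

theorem levelRatio_succ {m : ℝ} (hm : 1 < m) (n : ℕ) (N : List ℕ → ℕ) :
    levelRatio m (n + 1) N = (ENNReal.ofReal m)⁻¹ * branchSum (levelRatio m n) N := by
  have hmE : ENNReal.ofReal m ≠ 0 := by simp; linarith
  simp only [levelRatio, Function.iterate_succ_apply', branchSum]
  rw [← Finset.mul_sum, ← mul_assoc, pow_succ',
    ENNReal.mul_inv (Or.inl hmE) (Or.inl (by finiteness))]

theorem limsup_add_le_ennreal (u v : ℕ → ℝ≥0∞) :
    Filter.limsup (fun n => u n + v n) Filter.atTop ≤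
      Filter.limsup u Filter.atTop + Filter.limsup v Filter.atTop := by
  simp only [Filter.limsup_eq_iInf_iSup_of_nat]
  rw [ENNReal.iInf_add_iInf]
  · exact iInf_mono fun n => iSup₂_le fun i hi =>
      add_le_add (le_iSup₂_of_le i hi le_rfl) (le_iSup₂_of_le i hi le_rfl)
  · intro i j
    refine ⟨max i j, add_le_add ?_ ?_⟩
    · exact biSup_mono fun k hk => (le_max_left i j).trans hk
    · exact biSup_mono fun k hk => (le_max_right i j).trans hk

theorem limsup_sum_le_ennreal {ι : Type*} (s : Finset ι) (u : ι → ℕ → ℝ≥0∞) :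
    Filter.limsup (fun n => ∑ i ∈ s, u i n) Filter.atTop ≤
      ∑ i ∈ s, Filter.limsup (u i) Filter.atTop := by
  classical
  induction s using Finset.induction_on with
  | empty => simp
  | insert a s ha ih =>
    simp only [Finset.sum_insert ha]
    exact (limsup_add_le_ennreal _ _).trans (add_le_add le_rfl ih)

theorem limitRatio_eq_limsup_succ {m : ℝ} (hm : 1 < m) (N : List ℕ → ℕ) :
    limitRatio m N = (ENNReal.ofReal m)⁻¹ *
      Filter.limsup (fun n => branchSum (levelRatio m n) N) Filter.atTop := by
  have hmE : ENNReal.ofReal m ≠ 0 := by simp; linarith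
  rw [limitRatio, ← Filter.limsup_nat_add _ 1]
  simp_rw [levelRatio_succ hm]
  exact ENNReal.limsup_const_mul_of_ne_top (ENNReal.inv_ne_top.2 hmE)

theorem limitRatio_le_branchSum {m : ℝ} (hm : 1 < m) (N : List ℕ → ℕ) :
    limitRatio m N ≤ (ENNReal.ofReal m)⁻¹ * branchSum (limitRatio m) N := by
  rw [limitRatio_eq_limsup_succ hm]
  exact mul_le_mul_right (limsup_sum_le_ennreal _ _) _

theorem limitRatio_shift_le {m : ℝ} (hm : 1 < m) {N : List ℕ → ℕ} {i : ℕ} (hi : i < N []) :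
    limitRatio m (shift [i] N) ≤ ENNReal.ofReal m * limitRatio m N := by
  have hmE : ENNReal.ofReal m ≠ 0 := by simp; linarith
  rw [limitRatio_eq_limsup_succ hm N, ← mul_assoc, ENNReal.mul_inv_cancel hmE (by finiteness),
    one_mul]
  refine Filter.limsup_le_limsup (Filter.Eventually.of_forall fun n => ?_)
  exact Finset.single_le_sum (f := fun i => levelRatio m n (shift [i] N)) (fun _ _ => zero_le)
    (Finset.mem_range.2 hi)

/-- The normalised sum of the excess offspring numbers over level `j`, which is the increment of
the normalised level sizes. -/
noncomputable def increment (m : ℝ) (j : ℕ) (N : List ℕ → ℕ) : ℝ :=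
  (m ^ j)⁻¹ * branchSum^[j] (fun N => (N [] : ℝ) / m - 1) N

theorem measurable_excess (m : ℝ) : Measurable fun N : List ℕ → ℕ => (N [] : ℝ) / m - 1 :=
  ((measurable_from_top.comp (measurable_pi_apply ([] : List ℕ))).div_const m).sub_const 1

theorem measurable_increment (m : ℝ) (j : ℕ) : Measurable (increment m j) :=
  (measurable_iterate_branchSum (measurable_excess m) j).const_mul _

theorem card_level_eq_sum_increment {m : ℝ} (hm : 1 < m) (n : ℕ) (N : List ℕ → ℕ) :
    (m ^ n)⁻¹ * ((level N n).card : ℝ) = 1 + ∑ j ∈ Finset.range n, increment m j N := by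
  have hm0 : m ≠ 0 := by linarith
  induction n with
  | zero => simp [level]
  | succ n ih =>
    rw [Finset.sum_range_succ, ← add_assoc, ← ih, increment, ← sum_level_shift]
    have h : ((level N (n + 1)).card : ℝ) = ∑ v ∈ level N n, (N v : ℝ) := by
      have := sum_level_succ N n (fun _ => (1 : ℝ))
      simpa using this
    simp only [shift, List.nil_append]
    rw [h, Finset.sum_sub_distrib, ← Finset.sum_div]
    simp only [Finset.sum_const, nsmul_eq_mul, mul_one]
    field_simp
    ring

/-- A bound for all normalised level sizes. -/
noncomputable def ratioBound (m : ℝ) (N : List ℕ → ℕ) : ℝ≥0∞ :=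
  1 + ∑' j, ‖increment m j N‖ₑ

theorem measurable_ratioBound (m : ℝ) : Measurable (ratioBound m) :=
  measurable_const.add (Measurable.tsum fun j => (measurable_increment m j).enorm)

theorem levelRatio_le_ratioBound {m : ℝ} (hm : 1 < m) (n : ℕ) (N : List ℕ → ℕ) :
    levelRatio m n N ≤ ratioBound m N := by
  have hm0 : 0 < m := by linarith
  have e : levelRatio m n N = ENNReal.ofReal ((m ^ n)⁻¹ * ((level N n).card : ℝ)) := by
    rw [levelRatio_eq_card, ENNReal.ofReal_mul (by positivity),
      ENNReal.ofReal_inv_of_pos (by positivity), ENNReal.ofReal_pow hm0.le,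
      ENNReal.ofReal_natCast]
  rw [e, card_level_eq_sum_increment hm]
  calc _ ≤ ‖1 + ∑ j ∈ Finset.range n, increment m j N‖ₑ := Real.ofReal_le_enorm _
    _ ≤ ‖(1 : ℝ)‖ₑ + ∑ j ∈ Finset.range n, ‖increment m j N‖ₑ :=
      (enorm_add_le _ _).trans (add_le_add le_rfl (enorm_sum_le _ _))
    _ ≤ _ := by
      rw [enorm_one]
      exact add_le_add le_rfl (ENNReal.sum_le_tsum _)

theorem limitRatio_le_ratioBound {m : ℝ} (hm : 1 < m) (N : List ℕ → ℕ) :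
    limitRatio m N ≤ ratioBound m N :=
  Filter.limsup_le_of_le (h := Filter.Eventually.of_forall fun n => levelRatio_le_ratioBound hm n N)

section Moments

variable {q : PMF ℕ} {m : ℝ}

theorem lintegral_sq_inv_pow_mul_iterate_branchSum (hm : 1 < m)
    (hmean : ∑' n : ℕ, (n : ℝ≥0∞) * q n = ENNReal.ofReal m)
    {g : (List ℕ → ℕ) → ℝ} (hg : Measurable g) (h2 : ∫⁻ N, ‖g N‖ₑ ^ 2 ∂offspringLaw q < ∞)
    (h0 : ∫ N, g N ∂offspringLaw q = 0) (k : ℕ) :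
    ∫⁻ N, ‖(m ^ k)⁻¹ * branchSum^[k] g N‖ₑ ^ 2 ∂offspringLaw q =
      (ENNReal.ofReal m ^ k)⁻¹ * ∫⁻ N, ‖g N‖ₑ ^ 2 ∂offspringLaw q := by
  have hm0 : 0 < m := by linarith
  have hmE : ENNReal.ofReal m ^ k ≠ 0 := by simp; intro h; linarith
  have e : ‖(m ^ k)⁻¹‖ₑ = (ENNReal.ofReal m ^ k)⁻¹ := by
    rw [Real.enorm_of_nonneg (by positivity), ENNReal.ofReal_inv_of_pos (by positivity),
      ENNReal.ofReal_pow hm0.le]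
  simp_rw [enorm_mul, mul_pow, e]
  rw [lintegral_const_mul _ ((measurable_iterate_branchSum hg k).enorm.pow_const 2),
    lintegral_sq_iterate_branchSum hmean hg h2 h0 k, sq, ← mul_assoc, mul_assoc _ _ (_ ^ k),
    ENNReal.inv_mul_cancel hmE (by finiteness), mul_one]

theorem ofReal_sqrt_sq (hm : 1 < m) :
    ENNReal.ofReal (Real.sqrt m) * ENNReal.ofReal (Real.sqrt m) = ENNReal.ofReal m := by
  rw [← ENNReal.ofReal_mul (Real.sqrt_nonneg m), Real.mul_self_sqrt (by linarith)]

/-- The increments decay geometrically in mean square. -/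
theorem lintegral_sq_ratioBound_lt_top (hm : 1 < m)
    (hmean : ∑' n : ℕ, (n : ℝ≥0∞) * q n = ENNReal.ofReal m)
    (h2 : ∫⁻ N, ‖(N [] : ℝ) / m - 1‖ₑ ^ 2 ∂offspringLaw q < ∞)
    (h0 : ∫ N, ((N [] : ℝ) / m - 1) ∂offspringLaw q = 0) :
    ∫⁻ N, ratioBound m N ^ 2 ∂offspringLaw q < ∞ := by
  set R : ℝ≥0∞ := (ENNReal.ofReal (Real.sqrt m))⁻¹ with hR
  have hs1 : 1 < Real.sqrt m := by rw [Real.lt_sqrt (by norm_num)]; linarith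
  have hs0 : ENNReal.ofReal (Real.sqrt m) ≠ 0 := by simp; linarith
  have hR1 : R < 1 := by
    rw [hR, ENNReal.inv_lt_one]
    exact ENNReal.one_lt_ofReal.2 hs1
  have hR0 : R ≠ 0 := ENNReal.inv_ne_zero.2 (by finiteness)
  have hRt : R ≠ ∞ := (hR1.trans ENNReal.one_lt_top).ne
  have hsum : ∑' j, R ^ j ≠ ∞ := by
    rw [ENNReal.tsum_geometric]
    exact ENNReal.inv_ne_top.2 (tsub_pos_of_lt hR1).ne'
  have hsum0 : ∑' j, R ^ j ≠ 0 := by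
    rw [ENNReal.tsum_geometric]
    exact ENNReal.inv_ne_zero.2 (by finiteness)
  set K := ∫⁻ N, ‖(N [] : ℝ) / m - 1‖ₑ ^ 2 ∂offspringLaw q with hK
  have hRj : ∀ j : ℕ, (ENNReal.ofReal (Real.sqrt m) ^ j)⁻¹ = R ^ j := fun j => ENNReal.inv_pow
  have hinc : ∀ j, ∫⁻ N, ‖increment m j N‖ₑ ^ 2 / R ^ j ∂offspringLaw q = R ^ j * K := by
    intro j
    simp_rw [div_eq_mul_inv]
    rw [lintegral_mul_const _ ((measurable_increment m j).enorm.pow_const 2)]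
    simp_rw [increment]
    rw [lintegral_sq_inv_pow_mul_iterate_branchSum hm hmean (measurable_excess m) h2 h0 j,
      ← ofReal_sqrt_sq hm, mul_pow, ENNReal.mul_inv (Or.inr (by finiteness))
        (Or.inl (by finiteness)), hRj, mul_right_comm, mul_assoc (R ^ j),
      ENNReal.mul_inv_cancel (pow_ne_zero j hR0) (ENNReal.pow_ne_top hRt), mul_one]
  have hD : ∫⁻ N, (∑' j, ‖increment m j N‖ₑ) ^ 2 ∂offspringLaw q < ∞ := by
    calc _ ≤ ∫⁻ N, (∑' j, R ^ j) * ∑' j, ‖increment m j N‖ₑ ^ 2 / R ^ j ∂offspringLaw q := by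
          refine lintegral_mono fun N => ?_
          have := sq_tsum_div_tsum_le (a := fun j => ‖increment m j N‖ₑ) (fun j => enorm_ne_top)
            hsum
          rwa [ENNReal.div_le_iff hsum0 hsum, mul_comm] at this
      _ = (∑' j, R ^ j) * ((∑' j, R ^ j) * K) := by
          have hmeas : ∀ j, Measurable fun N => ‖increment m j N‖ₑ ^ 2 / R ^ j := fun j =>
            ((measurable_increment m j).enorm.pow_const 2).div_const _
          rw [lintegral_const_mul _ (Measurable.tsum hmeas),
            lintegral_tsum fun j => (hmeas j).aemeasurable]
          simp_rw [hinc, ENNReal.tsum_mul_right]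
      _ < ∞ := ENNReal.mul_lt_top hsum.lt_top (ENNReal.mul_lt_top hsum.lt_top h2)
  calc ∫⁻ N, ratioBound m N ^ 2 ∂offspringLaw q
      ≤ ∫⁻ N, (2 + 2 * (∑' j, ‖increment m j N‖ₑ) ^ 2) ∂offspringLaw q := by
        refine lintegral_mono fun N => ?_
        have := ENNReal.rpow_add_le_mul_rpow_add_rpow 1 (∑' j, ‖increment m j N‖ₑ)
          (p := 2) (by norm_num)
        norm_num [mul_add] at this
        exact this
    _ < ∞ := by
        rw [lintegral_add_left measurable_const, lintegral_const_mul _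
          ((Measurable.tsum fun j => (measurable_increment m j).enorm).pow_const 2)]
        simp only [lintegral_const, measure_univ, mul_one]
        exact ENNReal.add_lt_top.2 ⟨by norm_num, ENNReal.mul_lt_top (by norm_num) hD⟩

theorem ae_ratioBound_lt_top (h : ∫⁻ N, ratioBound m N ^ 2 ∂offspringLaw q < ∞) :
    ∀ᵐ N ∂offspringLaw q, ratioBound m N < ∞ := by
  filter_upwards [ae_lt_top ((measurable_ratioBound m).pow_const 2) h.ne] with N hN
  by_contra hcon
  rw [not_lt, top_le_iff] at hcon
  simp [hcon] at hN

theorem lintegral_sq_limitRatio_lt_top (hm : 1 < m)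
    (h : ∫⁻ N, ratioBound m N ^ 2 ∂offspringLaw q < ∞) :
    ∫⁻ N, limitRatio m N ^ 2 ∂offspringLaw q < ∞ :=
  (lintegral_mono fun N => pow_le_pow_left' (limitRatio_le_ratioBound hm N) 2).trans_lt h

theorem one_le_lintegral_limitRatio (hm : 1 < m)
    (hmean : ∑' n : ℕ, (n : ℝ≥0∞) * q n = ENNReal.ofReal m)
    (h : ∫⁻ N, ratioBound m N ^ 2 ∂offspringLaw q < ∞) :
    1 ≤ ∫⁻ N, limitRatio m N ∂offspringLaw q := by
  have hmE : ∀ n, ENNReal.ofReal m ^ n ≠ 0 := fun n => by simp; intro h; linarith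
  have h1 : ∫⁻ N, ratioBound m N ∂offspringLaw q ≠ ∞ := by
    refine ((lintegral_mono fun N => ?_).trans_lt h).ne
    rw [sq]
    exact le_mul_of_one_le_left' le_self_add
  have hone : ∀ n, ∫⁻ N, levelRatio m n N ∂offspringLaw q = 1 := fun n => by
    simp_rw [levelRatio]
    rw [lintegral_const_mul _ (measurable_iterate_branchSum measurable_const n),
      lintegral_iterate_branchSum hmean measurable_const n]
    simp [ENNReal.inv_mul_cancel (hmE n)]
  have := limsup_lintegral_le (μ := offspringLaw q) (f := levelRatio m) (ratioBound m)
    (measurable_levelRatio m)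
    (fun n => Filter.Eventually.of_forall fun N => levelRatio_le_ratioBound hm n N) h1
  simp only [hone, Filter.limsup_const] at this
  exact this

/-- Without leaves, the asymptotic size is almost surely positive: the probability `s` that it
vanishes satisfies `s ≤ ∑ q n * s ^ n`, and it is not `1`. -/
theorem ae_limitRatio_ne_zero (hm : 1 < m) (hq₀ : q 0 = 0)
    (hmean : ∑' n : ℕ, (n : ℝ≥0∞) * q n = ENNReal.ofReal m)
    (h : ∫⁻ N, ratioBound m N ^ 2 ∂offspringLaw q < ∞) :
    ∀ᵐ N ∂offspringLaw q, limitRatio m N ≠ 0 := by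
  set S : Set (List ℕ → ℕ) := {N | limitRatio m N = 0} with hS
  have hSm : MeasurableSet S := measurable_limitRatio m (measurableSet_singleton 0)
  set s := offspringLaw q S with hs
  have hs1 : s ≠ 1 := by
    intro h1
    have h2 : ∀ᵐ N ∂offspringLaw q, limitRatio m N = 0 := by
      rw [← prob_compl_eq_zero_iff hSm] at h1
      exact h1
    have h3 := one_le_lintegral_limitRatio hm hmean h
    rw [lintegral_congr_ae h2] at h3
    simp at h3
  have hle1 : s < 1 := lt_of_le_of_ne prob_le_one hs1
  suffices h0 : s = 0 by
    rw [ae_iff]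
    simpa only [not_not] using h0
  by_contra hs0
  have hle : s ≤ ∑' n, s ^ n * q n := by
    set f : ℕ → (List ℕ → ℕ) → ℝ≥0∞ := fun n =>
      (⋂ i ∈ Finset.range n, shift [i] ⁻¹' S).indicator 1 with hf
    have hfm : ∀ n, MeasurableSet (⋂ i ∈ Finset.range n, shift [i] ⁻¹' S) := fun n =>
      Finset.measurableSet_biInter _ fun i _ => measurable_shift [i] hSm
    have hprob : ∀ n, ∫⁻ N, f n N ∂offspringLaw q = s ^ n := fun n => by
      rw [lintegral_indicator_one (hfm n),
        (iIndepFun_shift q).measure_inter_preimage_eq_mul (Finset.range n) (sets := fun _ => S)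
          (fun i _ => hSm)]
      simp_rw [(measurePreserving_shift q _).measure_preimage hSm.nullMeasurableSet]
      simp [hs]
    have hroot := lintegral_root q (f := f) (fun n => measurable_one.indicator (hfm n))
      (fun n N k => by
        have : Function.update N [] k ∈ (⋂ i ∈ Finset.range n, shift [i] ⁻¹' S) ↔
            N ∈ (⋂ i ∈ Finset.range n, shift [i] ⁻¹' S) := by
          simp only [Set.mem_iInter, Set.mem_preimage, shift_update_nil]
        by_cases hN : N ∈ ⋂ i ∈ Finset.range n, shift [i] ⁻¹' S
        · simp only [hf, Set.indicator_of_mem hN, Set.indicator_of_mem (this.2 hN), Pi.one_apply]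
        · simp only [hf, Set.indicator_of_notMem hN, Set.indicator_of_notMem (mt this.1 hN)])
    simp_rw [hprob] at hroot
    rw [← hroot, hs, ← lintegral_indicator_one hSm]
    refine lintegral_mono fun N => ?_
    by_cases hN : N ∈ S
    swap
    · simp [hN]
    have hmem : N ∈ ⋂ i ∈ Finset.range (N []), shift [i] ⁻¹' S := by
      simp only [Set.mem_iInter, Finset.mem_range]
      intro i hi
      have := limitRatio_shift_le hm hi
      rw [show limitRatio m N = 0 from hN, mul_zero, nonpos_iff_eq_zero] at this
      exact this
    simp only [hf, Set.indicator_of_mem hmem, Set.indicator_of_mem hN, Pi.one_apply, le_refl]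
  obtain ⟨n, hn, hqn⟩ : ∃ n, 2 ≤ n ∧ q n ≠ 0 := by
    by_contra! hcon
    have : ∑' n : ℕ, (n : ℝ≥0∞) * q n ≤ ∑' n, q n := by
      refine ENNReal.tsum_le_tsum fun n => ?_
      rcases lt_or_ge n 2 with h2 | h2
      · interval_cases n <;> simp
      · simp [hcon n h2]
    rw [hmean, q.tsum_coe, ENNReal.ofReal_le_one] at this
    linarith
  have hst : s ≠ ∞ := (hle1.trans ENNReal.one_lt_top).ne
  have hlt : ∑' n, s ^ n * q n < ∑' n, s * q n := by
    refine ENNReal.tsum_lt_tsum (i := n) ?_ (fun k => ?_) ?_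
    · refine ne_top_of_le_ne_top ENNReal.one_ne_top (le_trans ?_ q.tsum_coe.le)
      exact ENNReal.tsum_le_tsum fun k => mul_le_of_le_one_left' (pow_le_one₀ zero_le hle1.le)
    · rcases Nat.eq_zero_or_pos k with rfl | hk
      · simp [hq₀]
      · exact mul_le_mul_left (pow_le_of_le_one zero_le hle1.le hk.ne') _
    · refine ENNReal.mul_lt_mul_left hqn (q.apply_ne_top n) ?_
      calc s ^ n ≤ s ^ 2 := pow_le_pow_of_le_one zero_le hle1.le hn
        _ = s * s := sq s
        _ < s * 1 := ENNReal.mul_lt_mul_right hs0 hst hle1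
        _ = s := mul_one s
  rw [ENNReal.tsum_mul_left, q.tsum_coe, mul_one] at hlt
  exact absurd hle (not_le.2 hlt)

end Moments

/-! ### The energy of the limit flow -/

/-- A truncation of a nonnegative number at geometrically growing levels has summable normalised
squares. -/
theorem sum_inv_pow_mul_min_sq_le {m w : ℝ} (hm : 1 < m) (hw : 0 ≤ w) (n : ℕ) :
    ∑ k ∈ Finset.range n, (m ^ k)⁻¹ * min w (m ^ k) ^ 2 ≤ 2 * m / (m - 1) * w := by
  have hm1 : 0 < m - 1 := by linarith
  -- a potential that increases by at least the summand in each step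
  suffices h : ∑ k ∈ Finset.range n, (m ^ k)⁻¹ * min w (m ^ k) ^ 2 ≤
      m / (m - 1) * (min w (m ^ n) * (2 - min w (m ^ n) / m ^ n)) by
    refine h.trans ?_
    have h1 : 0 ≤ min w (m ^ n) := le_min hw (by positivity)
    have h2 : min w (m ^ n) * (2 - min w (m ^ n) / m ^ n) ≤ 2 * w := by
      have h3 : 0 ≤ min w (m ^ n) / m ^ n := by positivity
      nlinarith [min_le_left w (m ^ n), mul_nonneg h1 h3]
    calc _ ≤ m / (m - 1) * (2 * w) := by gcongr
      _ = _ := by ring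
  induction n with
  | zero =>
    simp only [Finset.range_zero, Finset.sum_empty, pow_zero, div_one]
    have h1 : 0 ≤ min w 1 := le_min hw zero_le_one
    have h2 : min w 1 ≤ 1 := min_le_right w 1
    have h3 : 0 ≤ min w 1 * (2 - min w 1) := mul_nonneg h1 (by linarith)
    positivity
  | succ n ih =>
    rw [Finset.sum_range_succ]
    have hM : 0 < m ^ n := by positivity
    rw [pow_succ m n]
    set M := m ^ n
    suffices h : M⁻¹ * min w M ^ 2 + m / (m - 1) * (min w M * (2 - min w M / M)) ≤
        m / (m - 1) * (min w (M * m) * (2 - min w (M * m) / (M * m))) by linarith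
    have hMm : M ≤ M * m := le_mul_of_one_le_right hM.le hm.le
    rcases le_total w M with h1 | h1
    · rw [min_eq_left h1, min_eq_left (h1.trans hMm)]
      refine le_of_eq ?_
      field_simp
      ring
    · rw [min_eq_right h1]
      rcases le_total (M * m) w with h2 | h2
      · rw [min_eq_right h2]
        have e : m / (m - 1) * (M * m * (2 - M * m / (M * m))) -
            (M⁻¹ * M ^ 2 + m / (m - 1) * (M * (2 - M / M))) = M * (m - 1) := by
          field_simp
          ring
        nlinarith [mul_pos hM hm1]
      · rw [min_eq_left h2]
        have e : m / (m - 1) * (w * (2 - w / (M * m))) -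
            (M⁻¹ * M ^ 2 + m / (m - 1) * (M * (2 - M / M))) =
            (w - M) * (2 * (M * m) - w - M) / ((m - 1) * M) := by
          field_simp
          ring
        have h3 : 0 ≤ (w - M) * (2 * (M * m) - w - M) / ((m - 1) * M) :=
          div_nonneg (mul_nonneg (by linarith) (by linarith)) (by positivity)
        linarith

theorem limitRatio_shift_lt_top {m : ℝ} (hm : 1 < m) {N : List ℕ → ℕ} (h : limitRatio m N < ∞)
    {v : List ℕ} (hv : MemOffspring N v) : limitRatio m (shift v N) < ∞ := by
  induction v with
  | nil =>
    have : shift [] N = N := by funext w; simp [shift]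
    rwa [this]
  | cons i v ih =>
    have e : shift (i :: v) N = shift [i] (shift v N) := by funext w; simp [shift]
    rw [e]
    refine (limitRatio_shift_le hm ?_).trans_lt
      (ENNReal.mul_lt_top ENNReal.ofReal_lt_top (ih hv.1))
    simpa [shift] using hv.2

/-- The squared asymptotic size, truncated at `m ^ k`. -/
noncomputable def truncRatio (m : ℝ) (k : ℕ) (N : List ℕ → ℕ) : ℝ :=
  min ((limitRatio m N).toReal ^ 2) (m ^ k)

theorem measurable_truncRatio (m : ℝ) (k : ℕ) : Measurable (truncRatio m k) :=
  ((measurable_limitRatio m).ennreal_toReal.pow_const 2).min measurable_const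

theorem truncRatio_nonneg {m : ℝ} (hm : 0 < m) (k : ℕ) (N : List ℕ → ℕ) : 0 ≤ truncRatio m k N :=
  le_min (sq_nonneg _) (by positivity)

theorem ofReal_toReal_sq_le (x : ℝ≥0∞) : ENNReal.ofReal (x.toReal ^ 2) ≤ x ^ 2 := by
  rw [← ENNReal.toReal_pow]
  exact ENNReal.ofReal_toReal_le

section Energy

variable {q : PMF ℕ} {m : ℝ}

theorem lintegral_tsum_truncRatio_lt_top (hm : 1 < m)
    (h : ∫⁻ N, limitRatio m N ^ 2 ∂offspringLaw q < ∞) :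
    ∑' k, ∫⁻ N, ENNReal.ofReal ((m ^ k)⁻¹ * truncRatio m k N ^ 2) ∂offspringLaw q < ∞ := by
  have hm0 : 0 < m := by linarith
  have hmeas : ∀ k, Measurable fun N => ENNReal.ofReal ((m ^ k)⁻¹ * truncRatio m k N ^ 2) :=
    fun k => (((measurable_truncRatio m k).pow_const 2).const_mul _).ennreal_ofReal
  rw [← lintegral_tsum fun k => (hmeas k).aemeasurable]
  calc _ ≤ ∫⁻ N, ENNReal.ofReal (2 * m / (m - 1)) * limitRatio m N ^ 2 ∂offspringLaw q := by
        refine lintegral_mono fun N => ?_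
        rw [ENNReal.tsum_eq_iSup_nat]
        refine iSup_le fun n => ?_
        rw [← ENNReal.ofReal_sum_of_nonneg fun k _ => by positivity]
        refine (ENNReal.ofReal_le_ofReal
          (sum_inv_pow_mul_min_sq_le hm (sq_nonneg (limitRatio m N).toReal) n)).trans ?_
        rw [ENNReal.ofReal_mul (div_nonneg (by linarith) (by linarith))]
        exact mul_le_mul_right (ofReal_toReal_sq_le _) _
    _ < ∞ := by
        rw [lintegral_const_mul _ ((measurable_limitRatio m).pow_const 2)]
        exact ENNReal.mul_lt_top ENNReal.ofReal_lt_top h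

/-- Almost surely, all but finitely many levels have no subtree that the truncation affects. -/
theorem ae_eventually_truncRatio_eq (hm : 1 < m)
    (hmean : ∑' n : ℕ, (n : ℝ≥0∞) * q n = ENNReal.ofReal m)
    (h : ∫⁻ N, limitRatio m N ^ 2 ∂offspringLaw q < ∞) :
    ∀ᵐ N ∂offspringLaw q, ∀ᶠ k in Filter.atTop, ∀ v ∈ level N k,
      truncRatio m k (shift v N) = (limitRatio m (shift v N)).toReal ^ 2 := by
  have hm0 : 0 < m := by linarith
  set E : ℕ → Set (List ℕ → ℕ) := fun k => {N | m ^ k < (limitRatio m N).toReal ^ 2} with hE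
  have hEm : ∀ k, MeasurableSet (E k) := fun k =>
    measurableSet_lt measurable_const ((measurable_limitRatio m).ennreal_toReal.pow_const 2)
  set f : ℕ → (List ℕ → ℕ) → ℝ≥0∞ := fun k => branchSum^[k] ((E k).indicator 1) with hf
  have hfm : ∀ k, Measurable (f k) := fun k =>
    measurable_iterate_branchSum (measurable_one.indicator (hEm k)) k
  have hsum : ∫⁻ N, ∑' k, f k N ∂offspringLaw q ≠ ∞ := by
    rw [lintegral_tsum fun k => (hfm k).aemeasurable]
    refine ((ENNReal.tsum_le_tsum fun k => ?_).trans_lt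
      (lintegral_tsum_truncRatio_lt_top hm h)).ne
    simp only [hf]
    rw [lintegral_iterate_branchSum hmean (measurable_one.indicator (hEm k)),
      ← lintegral_const_mul _ (measurable_one.indicator (hEm k))]
    refine lintegral_mono fun N => ?_
    by_cases hN : N ∈ E k
    · have hN' : truncRatio m k N = m ^ k := min_eq_right (le_of_lt hN)
      simp only [Set.indicator_of_mem hN, Pi.one_apply, mul_one, hN']
      rw [← ENNReal.ofReal_pow hm0.le]
      refine ENNReal.ofReal_le_ofReal (le_of_eq ?_)
      field_simp
    · simp [hN]
  filter_upwards [ae_lt_top (Measurable.tsum hfm) hsum] with N hN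
  have htend := ENNReal.tendsto_atTop_zero_of_tsum_ne_top hN.ne
  filter_upwards [htend.eventually (gt_mem_nhds one_pos)] with k hk v hv
  refine min_eq_left (not_lt.1 fun hlt => ?_)
  simp only [hf] at hk
  rw [← sum_level_shift] at hk
  have h1 := Finset.single_le_sum (f := fun v => (E k).indicator 1 (shift v N))
    (fun _ _ => (zero_le : (0 : ℝ≥0∞) ≤ _)) hv
  have h2 : shift v N ∈ E k := hlt
  simp only [Set.indicator_of_mem h2, Pi.one_apply] at h1
  exact absurd hk (not_lt.2 h1)

theorem memLp_truncRatio (hm : 1 < m) (k : ℕ) : MemLp (truncRatio m k) 2 (offspringLaw q) := by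
  refine MemLp.of_bound (measurable_truncRatio m k).aestronglyMeasurable (m ^ k)
    (Filter.Eventually.of_forall fun N => ?_)
  rw [Real.norm_of_nonneg (truncRatio_nonneg (by linarith) k N)]
  exact min_le_right _ _

/-- Almost surely, the deviations of the truncated sums over the levels from their conditional
means are square summable. -/
theorem ae_tsum_sq_deviation_lt_top (hm : 1 < m)
    (hmean : ∑' n : ℕ, (n : ℝ≥0∞) * q n = ENNReal.ofReal m)
    (h : ∫⁻ N, limitRatio m N ^ 2 ∂offspringLaw q < ∞) :
    ∀ᵐ N ∂offspringLaw q, ∑' k, ‖(m ^ k)⁻¹ * branchSum^[k]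
      (fun N => truncRatio m k N - ∫ N', truncRatio m k N' ∂offspringLaw q) N‖ₑ ^ 2 < ∞ := by
  have hm0 : 0 < m := by linarith
  set g : ℕ → (List ℕ → ℕ) → ℝ :=
    fun k N => truncRatio m k N - ∫ N', truncRatio m k N' ∂offspringLaw q with hg
  have hgm : ∀ k, Measurable (g k) := fun k => (measurable_truncRatio m k).sub_const _
  have hmeas : ∀ k, Measurable fun N => ‖(m ^ k)⁻¹ * branchSum^[k] (g k) N‖ₑ ^ 2 := fun k =>
    ((measurable_iterate_branchSum (hgm k) k).const_mul _).enorm.pow_const 2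
  have hg2 : ∀ k, ∫⁻ N, ‖g k N‖ₑ ^ 2 ∂offspringLaw q ≤
      ∫⁻ N, ENNReal.ofReal (truncRatio m k N ^ 2) ∂offspringLaw q := fun k => by
    have h1 := ProbabilityTheory.ofReal_variance (memLp_truncRatio (q := q) hm k)
    rw [ProbabilityTheory.evariance] at h1
    simp only [hg]
    rw [← h1, ← ofReal_integral_eq_lintegral_ofReal (memLp_truncRatio hm k).integrable_sq
      (Filter.Eventually.of_forall fun N => sq_nonneg _)]
    exact ENNReal.ofReal_le_ofReal (ProbabilityTheory.variance_le_expectation_sq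
      (measurable_truncRatio m k).aestronglyMeasurable)
  have hgfin : ∀ k, ∫⁻ N, ‖g k N‖ₑ ^ 2 ∂offspringLaw q < ∞ := fun k => by
    refine (hg2 k).trans_lt ?_
    rw [← ofReal_integral_eq_lintegral_ofReal (memLp_truncRatio hm k).integrable_sq
      (Filter.Eventually.of_forall fun N => sq_nonneg _)]
    exact ENNReal.ofReal_lt_top
  have hg0 : ∀ k, ∫ N, g k N ∂offspringLaw q = 0 := fun k => by
    simp only [hg]
    rw [integral_sub ((memLp_truncRatio hm k).integrable one_le_two) (integrable_const _)]
    simp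
  refine ae_lt_top (Measurable.tsum hmeas) ?_
  rw [lintegral_tsum fun k => (hmeas k).aemeasurable]
  refine ((ENNReal.tsum_le_tsum fun k => ?_).trans_lt (lintegral_tsum_truncRatio_lt_top hm h)).ne
  rw [lintegral_sq_inv_pow_mul_iterate_branchSum hm hmean (hgm k) (hgfin k) (hg0 k)]
  refine (mul_le_mul_right (hg2 k) _).trans_eq ?_
  rw [← lintegral_const_mul _ ((measurable_truncRatio m k).pow_const 2).ennreal_ofReal]
  refine lintegral_congr fun N => ?_
  rw [ENNReal.ofReal_mul (by positivity), ENNReal.ofReal_inv_of_pos (by positivity),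
    ENNReal.ofReal_pow hm0.le]

/-- The energies of the limit flow at the successive levels are almost surely of the order of those
on an `m`-ary tree. -/
theorem ae_energy_lt_top (hm : 1 < m)
    (hmean : ∑' n : ℕ, (n : ℝ≥0∞) * q n = ENNReal.ofReal m)
    (h : ∫⁻ N, ratioBound m N ^ 2 ∂offspringLaw q < ∞) :
    ∀ᵐ N ∂offspringLaw q, ⨆ k, (ENNReal.ofReal m ^ k)⁻¹ *
      branchSum^[k] (fun N => limitRatio m N ^ 2) N < ∞ := by
  have hm0 : 0 < m := by linarith
  have hW := lintegral_sq_limitRatio_lt_top hm h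
  filter_upwards [ae_ratioBound_lt_top h, ae_eventually_truncRatio_eq hm hmean hW,
    ae_tsum_sq_deviation_lt_top hm hmean hW] with N hN htr hdev
  set S := ∑' k, ‖(m ^ k)⁻¹ * branchSum^[k]
      (fun N => truncRatio m k N - ∫ N', truncRatio m k N' ∂offspringLaw q) N‖ₑ ^ 2 with hS
  set c := ∫⁻ N, limitRatio m N ^ 2 ∂offspringLaw q with hc
  have hfin : limitRatio m N < ∞ := (limitRatio_le_ratioBound hm N).trans_lt hN
  obtain ⟨n, hn⟩ := Filter.eventually_atTop.1 htr
  set a : ℕ → ℝ≥0∞ := fun k => (ENNReal.ofReal m ^ k)⁻¹ *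
      branchSum^[k] (fun N => limitRatio m N ^ 2) N with ha
  have hafin : ∀ k, a k < ∞ := fun k => by
    simp only [ha]
    rw [← sum_level_shift]
    refine ENNReal.mul_lt_top ?_ (ENNReal.sum_lt_top.2 fun v hv => ENNReal.pow_lt_top
      (limitRatio_shift_lt_top hm hfin (mem_level.1 hv).2))
    rw [ENNReal.inv_lt_top]
    exact pos_iff_ne_zero.2 (pow_ne_zero k (ENNReal.ofReal_pos.2 hm0).ne')
  have hlarge : ∀ k ≥ n, a k ≤ 1 + S + c * ratioBound m N := by
    intro k hk
    set ck := ∫ N', truncRatio m k N' ∂offspringLaw q with hck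
    have hck' : ENNReal.ofReal ck ≤ c := by
      rw [hck, ofReal_integral_eq_lintegral_ofReal
        ((memLp_truncRatio hm k).integrable one_le_two)
        (Filter.Eventually.of_forall fun N => truncRatio_nonneg hm0 k N)]
      exact lintegral_mono fun N =>
        (ENNReal.ofReal_le_ofReal (min_le_left _ _)).trans (ofReal_toReal_sq_le _)
    have e1 : branchSum^[k] (fun N => limitRatio m N ^ 2) N =
        ENNReal.ofReal (∑ v ∈ level N k, truncRatio m k (shift v N)) := by
      rw [ENNReal.ofReal_sum_of_nonneg fun v _ => truncRatio_nonneg hm0 k _,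
        ← sum_level_shift]
      refine Finset.sum_congr rfl fun v hv => ?_
      have hvfin := limitRatio_shift_lt_top hm hfin (mem_level.1 hv).2
      rw [hn k hk v hv, ← ENNReal.toReal_pow, ENNReal.ofReal_toReal (ENNReal.pow_lt_top hvfin).ne]
    have e2 : (m ^ k)⁻¹ * ∑ v ∈ level N k, truncRatio m k (shift v N) =
        (m ^ k)⁻¹ * branchSum^[k] (fun N => truncRatio m k N - ck) N +
          ck * ((m ^ k)⁻¹ * ((level N k).card : ℝ)) := by
      rw [← sum_level_shift, Finset.sum_sub_distrib]
      simp only [Finset.sum_const, nsmul_eq_mul]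
      ring
    have e3 : (ENNReal.ofReal m ^ k)⁻¹ = ENNReal.ofReal ((m ^ k)⁻¹) := by
      rw [ENNReal.ofReal_inv_of_pos (by positivity), ENNReal.ofReal_pow hm0.le]
    have h1 : ENNReal.ofReal ((m ^ k)⁻¹ * branchSum^[k] (fun N => truncRatio m k N - ck) N) ≤
        1 + S := by
      refine (Real.ofReal_le_enorm _).trans ?_
      set y := ‖(m ^ k)⁻¹ * branchSum^[k] (fun N => truncRatio m k N - ck) N‖ₑ with hy
      have hyS : y ^ 2 ≤ S := ENNReal.le_tsum (f := fun k => ‖(m ^ k)⁻¹ * branchSum^[k]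
        (fun N => truncRatio m k N - ∫ N', truncRatio m k N' ∂offspringLaw q) N‖ₑ ^ 2) k
      rcases le_total y 1 with hy1 | hy1
      · exact hy1.trans le_self_add
      · refine le_trans ?_ (hyS.trans le_add_self)
        rw [sq]
        exact le_mul_of_one_le_left' hy1
    have h2 : ENNReal.ofReal (ck * ((m ^ k)⁻¹ * ((level N k).card : ℝ))) ≤
        c * ratioBound m N := by
      rw [ENNReal.ofReal_mul' (by positivity)]
      refine mul_le_mul' hck' ((le_of_eq ?_).trans (levelRatio_le_ratioBound hm k N))
      rw [levelRatio_eq_card, ENNReal.ofReal_mul (by positivity), e3, ENNReal.ofReal_natCast]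
    simp only [ha]
    rw [e1, e3, ← ENNReal.ofReal_mul (by positivity), e2]
    exact ENNReal.ofReal_add_le.trans (add_le_add h1 h2)
  refine (iSup_le fun k => ?_ : ⨆ k, a k ≤
    ∑ k ∈ Finset.range n, a k + (1 + S + c * ratioBound m N)).trans_lt ?_
  · rcases lt_or_ge k n with hk | hk
    · exact (Finset.single_le_sum (fun _ _ => zero_le) (Finset.mem_range.2 hk)).trans le_self_add
    · exact (hlarge k hk).trans le_add_self
  · exact ENNReal.add_lt_top.2 ⟨ENNReal.sum_lt_top.2 fun k _ => hafin k,
      ENNReal.add_lt_top.2 ⟨ENNReal.add_lt_top.2 ⟨ENNReal.one_lt_top, hdev⟩,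
        ENNReal.mul_lt_top hW hN⟩⟩

end Energy

/-! ### Comparison of regular trees -/

/-- The properties of a typical Galton-Watson tree that the comparison uses: the levels grow at
most like `m ^ k`, and the limit flow is nonzero and has the energy of the uniform flow on an
`m`-ary tree. -/
def IsRegular (m : ℝ) (N : List ℕ → ℕ) : Prop :=
  ⨆ k, levelRatio m k N < ∞ ∧
    ⨆ k, (ENNReal.ofReal m ^ k)⁻¹ * branchSum^[k] (fun N => limitRatio m N ^ 2) N < ∞ ∧
    limitRatio m N ≠ 0

/-- The hitting probabilities of two regular trees agree up to a constant factor, uniformly in the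
closed target and the law of the labels. -/
theorem IsRegular.exists_hitProb_le {m : ℝ} (hm : 1 < m) {N N' : List ℕ → ℕ}
    (hN : IsRegular m N) (hN' : IsRegular m N') :
    ∃ K : ℝ≥0∞, K ≠ ∞ ∧ ∀ (B : Set (ℕ → ℝ)) (F : ProbabilityMeasure ℝ), IsClosed B →
      (ofOffspring N).hitProb B F ≤ K * (ofOffspring N').hitProb B F := by
  classical
  have hm0 : 0 < m := by linarith
  have hmE : ENNReal.ofReal m ≠ 0 := by simp; linarith
  have hmk : ∀ k, ENNReal.ofReal m ^ k ≠ 0 := fun k => pow_ne_zero k hmE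
  set A : ℝ≥0∞ := ⨆ k, levelRatio m k N with hA
  have hAtop : A ≠ ∞ := hN.1.ne
  have hA1 : 1 ≤ A := (levelRatio_zero m N).symm.le.trans (le_iSup (fun k => levelRatio m k N) 0)
  have hcard : ∀ k, ((level N k).card : ℝ) ≤ A.toReal * m ^ k := fun k => by
    have h1 : levelRatio m k N ≤ A := le_iSup (fun k => levelRatio m k N) k
    rw [levelRatio_eq_card, mul_comm, ← div_eq_mul_inv,
      ENNReal.div_le_iff (hmk k) (by finiteness)] at h1
    have h2 := ENNReal.toReal_mono (by finiteness) h1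
    simpa [ENNReal.toReal_ofReal hm0.le] using h2
  set Y : ℝ≥0∞ := ⨆ k, (ENNReal.ofReal m ^ k)⁻¹ *
    branchSum^[k] (fun N => limitRatio m N ^ 2) N' with hY
  have hYtop : Y ≠ ∞ := hN'.2.1.ne
  have hW : limitRatio m N' < ∞ := by
    have h1 : limitRatio m N' ^ 2 ≤ Y := by
      have := le_iSup (fun k => (ENNReal.ofReal m ^ k)⁻¹ *
        branchSum^[k] (fun N => limitRatio m N ^ 2) N') 0
      simpa using this
    by_contra hcon
    rw [not_lt, top_le_iff] at hcon
    rw [hcon] at h1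
    simp at h1
    exact hYtop h1
  set δ : ℝ≥0∞ := ENNReal.ofReal ((m - 1) / (2 * m)) with hδ
  have hδ0 : δ ≠ 0 := (ENNReal.ofReal_pos.2 (div_pos (by linarith) (by linarith))).ne'
  set C : ℝ≥0∞ := Y / δ + 1 with hC
  have hC0 : C ≠ 0 := by simp [hC]
  have hCtop : C ≠ ∞ := ENNReal.add_ne_top.2 ⟨ENNReal.div_ne_top hYtop hδ0, ENNReal.one_ne_top⟩
  set θ : List ℕ → ℝ≥0∞ := fun v =>
    if MemOffspring N' v then (ENNReal.ofReal m ^ v.length)⁻¹ * limitRatio m (shift v N') else 0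
    with hθ
  have hθtop : ∀ v, θ v ≠ ∞ := fun v => by
    by_cases hv : MemOffspring N' v
    · simp only [hθ, if_pos hv]
      exact ENNReal.mul_ne_top (ENNReal.inv_ne_top.2 (hmk _))
        (limitRatio_shift_lt_top hm hW hv).ne
    · simp [hθ, hv]
  have hθ0 : θ [] ≠ 0 := by
    have h1 : MemOffspring N' [] := trivial
    have h2 : shift [] N' = N' := by funext w; simp [shift]
    simp only [hθ, if_pos h1, h2]
    simpa using hN'.2.2
  have hflow : ∀ v, θ v ≤ ∑ i ∈ Finset.range (N' v), θ (i :: v) := fun v => by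
    by_cases hv : MemOffspring N' v
    · have h1 : ∀ i ∈ Finset.range (N' v), θ (i :: v) = (ENNReal.ofReal m ^ v.length)⁻¹ *
          ((ENNReal.ofReal m)⁻¹ * limitRatio m (shift [i] (shift v N'))) := fun i hi => by
        have hiv : MemOffspring N' (i :: v) := ⟨hv, Finset.mem_range.1 hi⟩
        have e : shift (i :: v) N' = shift [i] (shift v N') := by funext w; simp [shift]
        simp only [hθ, if_pos hiv, e, List.length_cons]
        rw [pow_succ, ENNReal.mul_inv (Or.inr (by finiteness)) (Or.inr hmE), mul_assoc]
      rw [Finset.sum_congr rfl h1, ← Finset.mul_sum, ← Finset.mul_sum]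
      simp only [hθ, if_pos hv]
      refine mul_le_mul_right ((limitRatio_le_branchSum hm (shift v N')).trans_eq ?_) _
      simp [branchSum, shift]
    · simp [hθ, hv]
  have henergy : ∀ k, ∑ v ∈ level N' k, θ v ^ 2 ≤ C * δ * (ENNReal.ofReal m ^ k)⁻¹ := fun k => by
    have h1 : ∀ v ∈ level N' k, θ v ^ 2 = (ENNReal.ofReal m ^ k)⁻¹ *
        ((ENNReal.ofReal m ^ k)⁻¹ * limitRatio m (shift v N') ^ 2) := fun v hv => by
      obtain ⟨hl, hv'⟩ := mem_level.1 hv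
      simp only [hθ, if_pos hv', hl]
      ring
    rw [Finset.sum_congr rfl h1, ← Finset.mul_sum, ← Finset.mul_sum,
      sum_level_shift (fun N => limitRatio m N ^ 2), mul_comm]
    refine mul_le_mul_left ?_ _
    calc _ ≤ Y := le_iSup (fun k => (ENNReal.ofReal m ^ k)⁻¹ *
            branchSum^[k] (fun N => limitRatio m N ^ 2) N') k
      _ = Y / δ * δ := (ENNReal.div_mul_cancel hδ0 (by finiteness)).symm
      _ ≤ C * δ := mul_le_mul_left le_self_add _
  refine ⟨ENNReal.ofReal A.toReal * (C / θ [] ^ 2), ENNReal.mul_ne_top (by finiteness)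
    (ENNReal.div_ne_top hCtop (pow_ne_zero 2 hθ0)), fun B F hB => ?_⟩
  refine hitProb_le hB F (ENNReal.mul_ne_top (by finiteness)
    (ENNReal.div_ne_top hCtop (pow_ne_zero 2 hθ0))) fun n => ?_
  exact infinitePi_levelHit_le hm (by
    rw [← ENNReal.toReal_one]; exact ENNReal.toReal_mono hAtop hA1) hcard hC0 hCtop hθtop hθ0 hflow
    henergy (measurableSet_prefixClosure B n) n

/-! ### Galton-Watson trees are regular -/

theorem lintegral_offspring_root (q : PMF ℕ) (f : ℕ → ℝ≥0∞) :
    ∫⁻ N, f (N []) ∂offspringLaw q = ∑' n, f n * q n := by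
  have h := lintegral_root q (f := fun n _ => f n) (fun n => measurable_const) (fun _ _ _ => rfl)
  simpa using h

theorem tsum_natCast_mul_eq {q : PMF ℕ} {m : ℝ}
    (hmean : HasSum (fun n : ℕ => (n : ℝ) * (q n).toReal) m) :
    ∑' n : ℕ, (n : ℝ≥0∞) * q n = ENNReal.ofReal m := by
  rw [← hmean.tsum_eq, ENNReal.ofReal_tsum_of_nonneg (fun n => by positivity) hmean.summable]
  congr 1 with n
  rw [ENNReal.ofReal_mul (by positivity), ENNReal.ofReal_natCast,
    ENNReal.ofReal_toReal (q.apply_ne_top n)]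

theorem lintegral_sq_excess_lt_top {q : PMF ℕ} {m : ℝ} (hm : 1 < m)
    (hsq : Summable (fun n : ℕ => (n : ℝ) ^ 2 * (q n).toReal)) :
    ∫⁻ N, ‖(N [] : ℝ) / m - 1‖ₑ ^ 2 ∂offspringLaw q < ∞ := by
  rw [lintegral_offspring_root q fun n => ‖(n : ℝ) / m - 1‖ₑ ^ 2]
  have h1 : ∀ n : ℕ, ‖(n : ℝ) / m - 1‖ₑ ^ 2 * q n ≤
      ENNReal.ofReal ((n : ℝ) ^ 2 * (q n).toReal) + q n := fun n => by
    have h2 : ‖(n : ℝ) / m - 1‖ₑ ^ 2 ≤ ENNReal.ofReal ((n : ℝ) ^ 2) + 1 := by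
      rw [← enorm_pow, Real.enorm_of_nonneg (sq_nonneg _), ← ENNReal.ofReal_one,
        ← ENNReal.ofReal_add (by positivity) zero_le_one]
      refine ENNReal.ofReal_le_ofReal ?_
      have h3 : 0 ≤ (n : ℝ) / m := by positivity
      have h4 : (n : ℝ) / m ≤ n := div_le_self (by positivity) hm.le
      nlinarith
    calc _ ≤ (ENNReal.ofReal ((n : ℝ) ^ 2) + 1) * q n := mul_le_mul_left h2 _
      _ = _ := by
        rw [add_mul, one_mul, ENNReal.ofReal_mul (by positivity),
          ENNReal.ofReal_toReal (q.apply_ne_top n)]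
  refine (ENNReal.tsum_le_tsum h1).trans_lt ?_
  rw [ENNReal.tsum_add, q.tsum_coe, ← ENNReal.ofReal_tsum_of_nonneg (fun n => by positivity) hsq]
  exact ENNReal.add_lt_top.2 ⟨ENNReal.ofReal_lt_top, ENNReal.one_lt_top⟩

theorem integral_excess_eq_zero {q : PMF ℕ} {m : ℝ} (hm : 1 < m)
    (hmean : HasSum (fun n : ℕ => (n : ℝ) * (q n).toReal) m)
    (hsq : Summable (fun n : ℕ => (n : ℝ) ^ 2 * (q n).toReal)) :
    ∫ N, ((N [] : ℝ) / m - 1) ∂offspringLaw q = 0 := by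
  have hm0 : 0 < m := by linarith
  have hintg := (memLp_two_of_lintegral (measurable_excess m)
    (lintegral_sq_excess_lt_top hm hsq)).integrable one_le_two
  have hintg' : Integrable (fun N : List ℕ → ℕ => (N [] : ℝ) / m) (offspringLaw q) := by
    have := hintg.add (integrable_const (1 : ℝ))
    refine this.congr (Filter.Eventually.of_forall fun N => ?_)
    simp
  have h1 : ∫ N, (N [] : ℝ) ∂offspringLaw q = m := by
    rw [integral_eq_lintegral_of_nonneg_ae (Filter.Eventually.of_forall fun N => Nat.cast_nonneg _)
      ((measurable_from_top.comp (measurable_pi_apply ([] : List ℕ))).aestronglyMeasurable)]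
    simp_rw [ENNReal.ofReal_natCast]
    rw [lintegral_offspring_root q fun n => (n : ℝ≥0∞), tsum_natCast_mul_eq hmean,
      ENNReal.toReal_ofReal hm0.le]
  rw [integral_sub hintg' (integrable_const _), integral_div, h1, div_self hm0.ne']
  simp

theorem ae_isRegular {q : PMF ℕ} {m : ℝ} (hq₀ : q 0 = 0)
    (hmean : HasSum (fun n : ℕ => (n : ℝ) * (q n).toReal) m) (hm : 1 < m)
    (hsq : Summable (fun n : ℕ => (n : ℝ) ^ 2 * (q n).toReal)) :
    ∀ᵐ N ∂offspringLaw q, IsRegular m N := by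
  have hmean' := tsum_natCast_mul_eq hmean
  have h := lintegral_sq_ratioBound_lt_top hm hmean' (lintegral_sq_excess_lt_top hm hsq)
    (integral_excess_eq_zero hm hmean hsq)
  filter_upwards [ae_ratioBound_lt_top h, ae_energy_lt_top hm hmean' h,
    ae_limitRatio_ne_zero hm hq₀ hmean' h] with N h1 h2 h3
  exact ⟨(iSup_le fun k => levelRatio_le_ratioBound hm k N).trans_lt h1, h2, h3⟩

/-- The offspring numbers of a tree, extended by `0` to the words outside the tree. -/
noncomputable def offspringOf (Γ : PlaneTree) (v : List ℕ) : ℕ :=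
  {i : ℕ | i :: v ∈ Γ.verts}.ncard

theorem lt_offspringOf {Γ : PlaneTree} {v : List ℕ} {i : ℕ} :
    i < offspringOf Γ v ↔ i :: v ∈ Γ.verts := by
  set S : Set ℕ := {i : ℕ | i :: v ∈ Γ.verts} with hS
  have hfin : S.Finite := Γ.locallyFinite v
  constructor
  · intro h
    by_contra hi
    have hsub : S ⊆ Set.Iio i := fun j hj => by
      by_contra hij
      rw [Set.mem_Iio, not_lt] at hij
      rcases hij.eq_or_lt with rfl | hlt
      · exact hi hj
      · exact hi (Γ.sibling_mem j i v hlt hj)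
    have := Set.ncard_le_ncard hsub (Set.finite_Iio i)
    rw [Set.ncard_Iio_nat] at this
    exact absurd h (not_lt.2 this)
  · intro h
    have hsub : Set.Iio (i + 1) ⊆ S := fun j hj => by
      rcases (Nat.lt_succ_iff.1 hj).eq_or_lt with rfl | hlt
      · exact h
      · exact Γ.sibling_mem i j v hlt h
    have := Set.ncard_le_ncard hsub hfin
    rw [Set.ncard_Iio_nat] at this
    exact this

theorem ofOffspring_offspringOf (Γ : PlaneTree) : ofOffspring (offspringOf Γ) = Γ := by
  ext v
  change MemOffspring (offspringOf Γ) v ↔ v ∈ Γ.verts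
  induction v with
  | nil => exact ⟨fun _ => Γ.root_mem, fun _ => trivial⟩
  | cons i v ih =>
    exact ⟨fun h => lt_offspringOf.1 h.2,
      fun h => ⟨ih.2 (Γ.parent_mem i v h), lt_offspringOf.2 h⟩⟩

theorem measurable_offspringOf : Measurable offspringOf := by
  refine measurable_pi_lambda _ fun v => measurable_of_Ioi fun n => ?_
  have : (fun Γ => offspringOf Γ v) ⁻¹' Set.Ioi n = {Γ : PlaneTree | n :: v ∈ Γ.verts} := by
    ext Γ
    exact lt_offspringOf
  rw [this]
  exact MeasurableSpace.measurableSet_generateFrom ⟨n :: v, rfl⟩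

theorem offspringOf_ofOffspring {N : List ℕ → ℕ} {v : List ℕ} (hv : MemOffspring N v) :
    offspringOf (ofOffspring N) v = N v := by
  refine eq_of_forall_lt_iff fun n => ?_
  rw [lt_offspringOf]
  exact ⟨fun h => h.2, fun h => ⟨hv, h⟩⟩

/-- Two families of offspring numbers agree on the tree that the first one defines. -/
def AgreeOnTree (N N' : List ℕ → ℕ) : Prop :=
  ∀ v, MemOffspring N v → N' v = N v

theorem AgreeOnTree.shift {N N' : List ℕ → ℕ} (h : AgreeOnTree N N') {i : ℕ} (hi : i < N []) :
    AgreeOnTree (shift [i] N) (shift [i] N') := by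
  have key : ∀ v, MemOffspring (PlaneTree.shift [i] N) v → MemOffspring N (v ++ [i]) := by
    intro v
    induction v with
    | nil => exact fun _ => ⟨trivial, hi⟩
    | cons j v ih => exact fun hv => ⟨ih hv.1, hv.2⟩
  exact fun v hv => h _ (key v hv)

theorem AgreeOnTree.iterate_branchSum {M : Type*} [AddCommMonoid M] {g : (List ℕ → ℕ) → M}
    (hg : ∀ N N', AgreeOnTree N N' → g N' = g N) (k : ℕ) {N N' : List ℕ → ℕ}
    (h : AgreeOnTree N N') : branchSum^[k] g N' = branchSum^[k] g N := by
  induction k generalizing N N' with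
  | zero => exact hg N N' h
  | succ k ih =>
    rw [Function.iterate_succ_apply']
    simp only [branchSum]
    rw [h [] trivial]
    exact Finset.sum_congr rfl fun i hi => ih (h.shift (Finset.mem_range.1 hi))

/-- Regularity is a property of the tree, so that it passes from the offspring numbers that generate
a random tree to those that are read off from it. -/
theorem AgreeOnTree.isRegular {m : ℝ} {N N' : List ℕ → ℕ} (h : AgreeOnTree N N')
    (hN : IsRegular m N) : IsRegular m N' := by
  have h1 : ∀ N N' : List ℕ → ℕ, AgreeOnTree N N' → ∀ k, levelRatio m k N' = levelRatio m k N :=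
    fun N N' h k => by rw [levelRatio, levelRatio, h.iterate_branchSum (fun _ _ _ => rfl)]
  have h2 : ∀ N N' : List ℕ → ℕ, AgreeOnTree N N' → limitRatio m N' = limitRatio m N :=
    fun N N' h => by simp only [limitRatio, h1 N N' h]
  have h3 : ∀ k, branchSum^[k] (fun N => limitRatio m N ^ 2) N' =
      branchSum^[k] (fun N => limitRatio m N ^ 2) N := fun k =>
    h.iterate_branchSum (fun N N' h => by simp only [h2 N N' h]) k
  simp only [IsRegular, h1 N N' h, h2 N N' h, h3]
  exact hN

theorem measurableSet_isRegular (m : ℝ) : MeasurableSet {N | IsRegular m N} := by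
  have h1 : Measurable fun N => ⨆ k, levelRatio m k N :=
    Measurable.iSup fun k => measurable_levelRatio m k
  have h2 : Measurable fun N => ⨆ k, (ENNReal.ofReal m ^ k)⁻¹ *
      branchSum^[k] (fun N => limitRatio m N ^ 2) N :=
    Measurable.iSup fun k => (measurable_iterate_branchSum
      ((measurable_limitRatio m).pow_const 2) k).const_mul _
  exact (measurableSet_lt h1 measurable_const).inter ((measurableSet_lt h2 measurable_const).inter
    (measurable_limitRatio m (measurableSet_singleton 0)).compl)

theorem ae_galtonWatson_isRegular {q : PMF ℕ} {m : ℝ} (hq₀ : q 0 = 0)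
    (hmean : HasSum (fun n : ℕ => (n : ℝ) * (q n).toReal) m) (hm : 1 < m)
    (hsq : Summable (fun n : ℕ => (n : ℝ) ^ 2 * (q n).toReal)) :
    ∀ᵐ Γ ∂galtonWatson q, IsRegular m (offspringOf Γ) := by
  have hmeas : MeasurableSet {Γ : PlaneTree | IsRegular m (offspringOf Γ)} :=
    measurable_offspringOf (measurableSet_isRegular m)
  rw [galtonWatson, ae_map_iff measurable_ofOffspring.aemeasurable hmeas]
  filter_upwards [ae_isRegular hq₀ hmean hm hsq] with N hN
  exact AgreeOnTree.isRegular (fun v hv => offspringOf_ofOffspring hv) hN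

end PlaneTree

/-- The supremum is taken in `[0, ∞]`, where `0 / 0 = 0` and `a / 0 = ∞` for `a > 0`. -/
theorem theorem1p1 (q q' : PMF ℕ) (m : ℝ)
    (hq₀ : q 0 = 0) (hq₀' : q' 0 = 0)
    (hmean : HasSum (fun n : ℕ => (n : ℝ) * (q n).toReal) m)
    (hmean' : HasSum (fun n : ℕ => (n : ℝ) * (q' n).toReal) m)
    (hm : 1 < m)
    (hsq : Summable (fun n : ℕ => (n : ℝ) ^ 2 * (q n).toReal))
    (hsq' : Summable (fun n : ℕ => (n : ℝ) ^ 2 * (q' n).toReal)) :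
    ∀ᵐ p : PlaneTree × PlaneTree ∂(PlaneTree.galtonWatson q).prod (PlaneTree.galtonWatson q'),
      PlaneTree.Equipolar p.1 p.2 ∧
      (⨆ (B : TopologicalSpace.Closeds (ℕ → ℝ)) (F : ProbabilityMeasure ℝ),
        p.1.hitProb (B : Set (ℕ → ℝ)) F / p.2.hitProb (B : Set (ℕ → ℝ)) F) < ∞ := by
  filter_upwards [Measure.quasiMeasurePreserving_fst.ae
      (PlaneTree.ae_galtonWatson_isRegular hq₀ hmean hm hsq),
    Measure.quasiMeasurePreserving_snd.ae
      (PlaneTree.ae_galtonWatson_isRegular hq₀' hmean' hm hsq')] with p h h'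
  obtain ⟨K, hK, hle⟩ := h.exists_hitProb_le hm h'
  obtain ⟨K', -, hle'⟩ := h'.exists_hitProb_le hm h
  simp only [PlaneTree.ofOffspring_offspringOf] at hle hle'
  refine ⟨fun F B hB => ⟨fun h0 => ?_, fun h0 => ?_⟩, ?_⟩
  · have := hle' B F hB
    rw [show p.1.hitProb B F = 0 from h0, mul_zero] at this
    exact le_antisymm this zero_le
  · have := hle B F hB
    rw [show p.2.hitProb B F = 0 from h0, mul_zero] at this
    exact le_antisymm this zero_le
  · refine (iSup₂_le fun B F => ?_).trans_lt hK.lt_top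
    exact ENNReal.div_le_of_le_mul (hle B F B.isClosed)
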